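/- Let $\Lambda$ be a free $\mathbb Z$-module of finite rank and $J$ an integer-valued bilinear form on $\Lambda$; put $I(m,n)=J(m,n)+J(n,m)$, and write $J,I$ also for the $\mathbb R$-bilinear extensions to $\mathfrak t=\Lambda\otimes\mathbb R$. Let $T=\Lambda\otimes U(1)$, write $\exp(r)=e^{2\pi i r}\in U(1)$ for $r\in\mathbb R$, and let $\exp\colon\mathfrak t\to T$ be the induced homomorphism, with kernel $\Lambda$. Let $P_1T$ be the group of smooth paths $[0,1]\to T$ starting at the unit, and $\Omega T\subset P_1T$ the subgroup of closed paths. For $\varphi,\gamma\in P_1T$ let $f,g\colon[0,1]\to\mathfrak t$ be their lifts starting at $0$. In a crossed module $\partial\colon H\to G$ the group $G$ acts on $H$ from the right, $h\mapsto h^x$, with $\partial(h^x)=x^{-1}\partial(h)x$ and $h^{\partial k}=k^{-1}hk$. The corresponding categorical group has object set $G$, arrows $x\to x\,\partial h$ labelled by $h\in H$, composition given by multiplication of labels, and tensor product $(x\xrightarrow{h}x\,\partial h)\otimes(y\xrightarrow{k}y\,\partial k)=(xy\xrightarrow{h^yk}xy\,\partial(h^yk))$. Consider the crossed modules: * $\Pi\colon\widetilde{\Omega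 T}\to P_1T$, $(z,\gamma)\mapsto\gamma$, where $\widetilde{\Omega T}=U(1)\times\Omega T$ is the central extension with multiplication $(z,\varphi)(w,\gamma)=(zw\,c(\varphi,\gamma)^{-1},\varphi\gamma)$, $c(\varphi,\gamma)=\exp\left(\int_0^1J(f(t),\dot g(t))\,dt\right)$, and $(z,\gamma)^\varphi=\left(z\exp\left(\int_0^1I(f(t),\dot g(t))\,dt\right),\gamma\right)$; * $\Xi\colon\widetilde\Lambda\to\mathfrak t$, $(z,m)\mapsto m$, where $\widetilde\Lambda=U(1)\times\Lambda$ is the central extension with multiplication $(z,m)(w,n)=(zw(-1)^{J(m,n)},m+n)$, and $(z,m)^x=\left(z\exp\left(\tfrac12I(x,m)\right),m\right)$; * $\Psi\colon\Lambda\times U(1)\to\mathfrak t$, $(m,z)\mapsto m$, with $(m,z)^x=(m,z\exp(J(m,x)))$. All these groups carry their usual smooth structures (a family of paths being smooth if it is jointly smooth in the parameters of the family and in $t\in[0,1]$). A monoidal functor between two of the categorical groups is called an equivalence of categorical Lie groups if it is a monoidal equivalence of categories, it and its tensor constraint are smooth, and it is a weak equivalence of the underlying Lie groupoids (smoothly essentially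 surjective and smoothly fully faithful). **Lemma.** For $x\in\mathfrak t$ let $\gamma_x\in P_1T$ be the path $\gamma_x(t)=\exp(tx)$. 1. The maps $x\mapsto\gamma_x$, $\mathfrak t\to P_1T$, and $(z,m)\mapsto(z,\gamma_m)$, $\widetilde\Lambda\to\widetilde{\Omega T}$, are injective group homomorphisms and form a map of crossed modules $\Xi\to\Pi$. The induced monoidal functor is an equivalence of categorical Lie groups; thus $\Xi$ is an equivalent sub-crossed module of $\Pi$. 2. Consequently, the loop-group crossed module $\Pi$ gives the same categorical torus as $\Psi$: there is a monoidal functor from the categorical group of $\Psi$ to that of $\Pi$ which is an equivalence of categorical Lie groups, sends each object $x\in\mathfrak t$ to $\gamma_x$, and sends the automorphism $(0,z)$ of each object $x$ to the automorphism of $\gamma_x$ with label $(z,1)$. -/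

import Mathlib

open scoped TensorProduct ContDiff

noncomputable section

namespace CatTorus

universe u v

/-! ## Crossed modules and their categorical groups -/

/-- A crossed module `bd : H → G`, with `G` acting on `H` from the right; `act x h` is `h ^ x`. -/
structure CrossedModule (H : Type u) (G : Type v) [Group H] [Group G] where
  bd : H →* G
  act : G → H →* H
  act_one : ∀ h, act 1 h = h
  act_mul : ∀ x y h, act (x * y) h = act y (act x h)
  bd_act : ∀ x h, bd (act x h) = x⁻¹ * bd h * x
  peiffer : ∀ k h, act (bd k) h = k⁻¹ * h * k

section CategoricalGroup

variable {H : Type u} {G : Type v} [Group H] [Group G]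

/-- The strict categorical group of a crossed module: its objects are the elements of `G`. -/
@[ext]
structure TwoGroup (X : CrossedModule H G) where
  val : G

/-- An arrow `x ⟶ y` is an element `h` of `H` with `y = x * bd h`. -/
@[ext]
structure TwoGroup.Arrow {X : CrossedModule H G} (x y : TwoGroup X) where
  val : H
  target : x.val * X.bd val = y.val

instance (X : CrossedModule H G) : CategoryTheory.Category (TwoGroup X) where
  Hom x y := TwoGroup.Arrow x y
  id x := ⟨1, by simp⟩
  comp f g := ⟨f.val * g.val, by rw [map_mul, ← mul_assoc, f.target, g.target]⟩
  id_comp f := TwoGroup.Arrow.ext (one_mul _)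
  comp_id f := TwoGroup.Arrow.ext (mul_one _)
  assoc f g h := TwoGroup.Arrow.ext (mul_assoc _ _ _)

namespace TwoGroup

variable {X : CrossedModule H G}

/-- The element of `H` underlying an arrow. -/
def label {x y : TwoGroup X} (f : x ⟶ y) : H := Arrow.val f

/-- The arrow with source `x` and label `h`. -/
def arrow (X : CrossedModule H G) (x : G) (h : H) :
    (⟨x⟩ : TwoGroup X) ⟶ ⟨x * X.bd h⟩ := ⟨h, rfl⟩

@[ext]
lemma hom_ext {x y : TwoGroup X} {f g : x ⟶ y} (h : label f = label g) : f = g := Arrow.ext h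

lemma label_target {x y : TwoGroup X} (f : x ⟶ y) : x.val * X.bd (label f) = y.val :=
  Arrow.target f

@[simp] lemma label_id (x : TwoGroup X) : label (CategoryTheory.CategoryStruct.id x) = 1 := rfl

@[simp] lemma label_comp {x y z : TwoGroup X} (f : x ⟶ y) (g : y ⟶ z) :
    label (CategoryTheory.CategoryStruct.comp f g) = label f * label g := rfl

/-- Equal objects are isomorphic through the arrow with label `1`. -/
def isoOfEq {x y : TwoGroup X} (h : x.val = y.val) : x ≅ y where
  hom := ⟨1, by simpa using h⟩
  inv := ⟨1, by simpa using h.symm⟩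
  hom_inv_id := hom_ext (one_mul 1)
  inv_hom_id := hom_ext (one_mul 1)

@[simp] lemma label_isoOfEq_hom {x y : TwoGroup X} (h : x.val = y.val) :
    label (isoOfEq h).hom = 1 := rfl

@[simp] lemma label_isoOfEq_inv {x y : TwoGroup X} (h : x.val = y.val) :
    label (isoOfEq h).inv = 1 := rfl

instance : CategoryTheory.MonoidalCategoryStruct (TwoGroup X) where
  tensorObj x y := ⟨x.val * y.val⟩
  tensorUnit := ⟨1⟩
  tensorHom {x x' y y'} f g := ⟨X.act y.val (label f) * label g, by
    rw [map_mul, X.bd_act, ← label_target f, ← label_target g]; group⟩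
  whiskerLeft x {y y'} g := ⟨label g, by rw [← label_target g, mul_assoc]⟩
  whiskerRight {x x'} f y := ⟨X.act y.val (label f), by
    rw [X.bd_act, ← label_target f]; group⟩
  associator x y z := isoOfEq (mul_assoc _ _ _)
  leftUnitor x := isoOfEq (one_mul _)
  rightUnitor x := isoOfEq (mul_one _)

open CategoryTheory MonoidalCategory

@[simp] lemma tensorObj_val (x y : TwoGroup X) : (x ⊗ y).val = x.val * y.val := rfl

@[simp] lemma tensorUnit_val : (𝟙_ (TwoGroup X)).val = 1 := rfl

@[simp] lemma label_tensorHom {x x' y y' : TwoGroup X} (f : x ⟶ x') (g : y ⟶ y') :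
    label (f ⊗ₘ g) = X.act y.val (label f) * label g := rfl

@[simp] lemma label_whiskerLeft (x : TwoGroup X) {y y' : TwoGroup X} (g : y ⟶ y') :
    label (x ◁ g) = label g := rfl

@[simp] lemma label_whiskerRight {x x' : TwoGroup X} (f : x ⟶ x') (y : TwoGroup X) :
    label (f ▷ y) = X.act y.val (label f) := rfl

@[simp] lemma label_associator_hom (x y z : TwoGroup X) : label (α_ x y z).hom = 1 := rfl

@[simp] lemma label_leftUnitor_hom (x : TwoGroup X) : label (λ_ x).hom = 1 := rfl

@[simp] lemma label_rightUnitor_hom (x : TwoGroup X) : label (ρ_ x).hom = 1 := rfl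

instance : MonoidalCategory (TwoGroup X) where
  tensorHom_def f g := by ext; simp
  id_tensorHom_id x y := by ext; simp
  tensorHom_comp_tensorHom {x₁ y₁ z₁ x₂ y₂ z₂} f₁ f₂ g₁ g₂ := by
    ext
    simp only [label_comp, label_tensorHom, map_mul, ← label_target f₂, X.act_mul, X.peiffer]
    group
  whiskerLeft_id x y := by ext; simp
  id_whiskerRight x y := by ext; simp
  associator_naturality f₁ f₂ f₃ := by ext; simp [X.act_mul, mul_assoc]
  leftUnitor_naturality f := by ext; simp
  rightUnitor_naturality f := by ext; simp [X.act_one]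
  pentagon w x y z := by ext; simp
  triangle x y := by ext; simp

end TwoGroup

/-- A (strict) map of crossed modules. -/
structure CrossedModule.Hom {H : Type*} {G : Type*} [Group H] [Group G]
    {H' : Type*} {G' : Type*} [Group H'] [Group G']
    (X : CrossedModule H G) (Y : CrossedModule H' G') where
  top : H →* H'
  base : G →* G'
  bd_top : ∀ h, Y.bd (top h) = base (X.bd h)
  top_act : ∀ x h, top (X.act x h) = Y.act (base x) (top h)

end CategoricalGroup

section Functor

open CategoryTheory MonoidalCategory

variable {H : Type*} {G : Type*} [Group H] [Group G] {H' : Type*} {G' : Type*} [Group H'] [Group G']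
  {X : CrossedModule H G} {Y : CrossedModule H' G'}

/-- The functor of categorical groups induced by a map of crossed modules. -/
def CrossedModule.Hom.functor (f : CrossedModule.Hom X Y) : TwoGroup X ⥤ TwoGroup Y where
  obj x := ⟨f.base x.val⟩
  map a := ⟨f.top (TwoGroup.label a), by rw [f.bd_top, ← map_mul, TwoGroup.label_target]⟩
  map_id x := TwoGroup.hom_ext (map_one f.top)
  map_comp a b := TwoGroup.hom_ext (map_mul f.top _ _)

@[simp] lemma CrossedModule.Hom.functor_obj_val (f : CrossedModule.Hom X Y) (x : TwoGroup X) :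
    (f.functor.obj x).val = f.base x.val := rfl

@[simp] lemma CrossedModule.Hom.label_functor_map (f : CrossedModule.Hom X Y) {x y : TwoGroup X}
    (a : x ⟶ y) : TwoGroup.label (f.functor.map a) = f.top (TwoGroup.label a) := rfl

/-- The tensor constraint of the induced functor: the arrow with label `1`. -/
def CrossedModule.Hom.muIso (f : CrossedModule.Hom X Y) (x y : TwoGroup X) :
    f.functor.obj x ⊗ f.functor.obj y ≅ f.functor.obj (x ⊗ y) :=
  TwoGroup.isoOfEq (by simp)

/-- The unit constraint of the induced functor: the arrow with label `1`. -/
def CrossedModule.Hom.epsIso (f : CrossedModule.Hom X Y) :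
    𝟙_ (TwoGroup Y) ≅ f.functor.obj (𝟙_ (TwoGroup X)) :=
  TwoGroup.isoOfEq (by simp)

@[simp] lemma CrossedModule.Hom.label_muIso (f : CrossedModule.Hom X Y) (x y : TwoGroup X) :
    TwoGroup.label (f.muIso x y).hom = 1 := rfl

@[simp] lemma CrossedModule.Hom.label_epsIso (f : CrossedModule.Hom X Y) :
    TwoGroup.label f.epsIso.hom = 1 := rfl

/-- The induced functor is strictly monoidal. -/
instance (f : CrossedModule.Hom X Y) : f.functor.Monoidal :=
  Functor.CoreMonoidal.toMonoidal
    { εIso := f.epsIso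
      μIso := f.muIso
      μIso_hom_natural_left := fun a z => by ext; simp [f.top_act]
      μIso_hom_natural_right := fun z a => by ext; simp
      associativity := fun x y z => by ext; simp
      left_unitality := fun x => by ext; simp
      right_unitality := fun x => by ext; simp }

end Functor

/-! ## Smooth structures (diffeologies) and smooth equivalences -/

section Smooth

open Diffeology CategoryTheory

/-- The product diffeology. -/
instance {A B : Type*} [DiffeologicalSpace A] [DiffeologicalSpace B] :
    DiffeologicalSpace (A × B) where
  plots n := {p | IsPlot (fun u => (p u).1) ∧ IsPlot (fun u => (p u).2)}
  constant_plots x := ⟨isPlot_const, isPlot_const⟩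
  plot_reparam hp hf := ⟨isPlot_reparam hp.1 hf, isPlot_reparam hp.2 hf⟩
  locality hp := by
    refine ⟨DiffeologicalSpace.locality fun x => ?_, DiffeologicalSpace.locality fun x => ?_⟩
    · obtain ⟨U, hU, hx, h⟩ := hp x
      exact ⟨U, hU, hx, fun hf hf' => (h hf hf').1⟩
    · obtain ⟨U, hU, hx, h⟩ := hp x
      exact ⟨U, hU, hx, fun hf hf' => (h hf hf').2⟩

/-- The diffeology induced by a map: a map is a plot if its composite with `f` is one. -/
abbrev inducedDiffeology {A B : Type*} [DiffeologicalSpace B] (f : A → B) :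
    DiffeologicalSpace A where
  plots n := {p | IsPlot (fun u => f (p u))}
  constant_plots x := isPlot_const
  plot_reparam hp hf := isPlot_reparam (X := B) hp hf
  locality hp := DiffeologicalSpace.locality (X := B) hp

instance {A : Type*} [DiffeologicalSpace A] : DiffeologicalSpace (Multiplicative A) :=
  inducedDiffeology Multiplicative.toAdd

lemma contDiffOn_of_local {E F V : Type*} [NormedAddCommGroup E] [InnerProductSpace ℝ E]
    [NormedAddCommGroup F] [NormedSpace ℝ F] [NormedAddCommGroup V] [NormedSpace ℝ V]
    {S : Set F} {g : E × F → V}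
    (h : ∀ x : E, ∃ U : Set E, IsOpen U ∧ x ∈ U ∧ ∀ f : E → E, (∀ y, f y ∈ U) →
      ContDiff ℝ ∞ f → ContDiffOn ℝ ∞ (fun q : E × F => g (f q.1, q.2)) (Set.univ ×ˢ S)) :
    ContDiffOn ℝ ∞ g (Set.univ ×ˢ S) := by
  rintro ⟨x, s⟩ ⟨-, hs⟩
  obtain ⟨U, hU, hx, h⟩ := h x
  obtain ⟨ε, hε, hεU⟩ := Metric.isOpen_iff.mp hU x hx
  set e := OpenPartialHomeomorph.univBall x ε with he
  have htgt : e.target = Metric.ball x ε := OpenPartialHomeomorph.univBall_target x hε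
  have hmem : ∀ y, e y ∈ Metric.ball x ε := fun y => by
    rw [← htgt]
    exact e.map_source (by rw [he, OpenPartialHomeomorph.univBall_source]; trivial)
  have h1 := h e (fun y => hεU (hmem y)) OpenPartialHomeomorph.contDiff_univBall
  have h2 : ContDiffOn ℝ ∞ (fun q : E × F => (e.symm q.1, q.2)) (Metric.ball x ε ×ˢ S) :=
    ContDiffOn.prodMk
      ((OpenPartialHomeomorph.contDiffOn_univBall_symm (c := x) (r := ε)).comp
        contDiff_fst.contDiffOn fun q hq => hq.1) contDiff_snd.contDiffOn
  have h3 : ContDiffOn ℝ ∞ g (Metric.ball x ε ×ˢ S) :=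
    (h1.comp h2 fun q hq => ⟨trivial, hq.2⟩).congr fun q hq => by
      change g q = g (e (e.symm q.1), q.2)
      rw [e.right_inv (by rw [htgt]; exact hq.1)]
  refine (h3 (x, s) ⟨Metric.mem_ball_self hε, hs⟩).mono_of_mem_nhdsWithin ?_
  have : Metric.ball x ε ×ˢ (Set.univ : Set F) ∈ nhds (x, s) :=
    prod_mem_nhds (Metric.ball_mem_nhds x hε) Filter.univ_mem
  filter_upwards [mem_nhdsWithin_of_mem_nhds this, self_mem_nhdsWithin] with q hq hq'
  exact ⟨hq.1, hq'.2⟩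

/-- The diffeology whose plots are the maps that become jointly smooth (in the parameter of the
plot and in the point `s` of `S`) after every one of the functions `ob i · s`. -/
abbrev familyDiffeology {A ι F V : Type*} [NormedAddCommGroup F] [NormedSpace ℝ F]
    [NormedAddCommGroup V] [NormedSpace ℝ V] (S : Set F) (ob : ι → A → F → V)
    (hob : ∀ i a, ContDiffOn ℝ ∞ (ob i a) S) : DiffeologicalSpace A where
  plots n := {p | ∀ i, ContDiffOn ℝ ∞
    (fun q : EuclideanSpace ℝ (Fin n) × F => ob i (p q.1) q.2) (Set.univ ×ˢ S)}
  constant_plots a i := (hob i a).comp contDiff_snd.contDiffOn fun q hq => hq.2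
  plot_reparam {n m p f} hp hf i := (hp i).comp
    ((hf.comp contDiff_fst).prodMk contDiff_snd).contDiffOn fun q hq => ⟨trivial, hq.2⟩
  locality {n p} hp i := contDiffOn_of_local
    (g := fun q : EuclideanSpace ℝ (Fin n) × F => ob i (p q.1) q.2) fun x => by
      obtain ⟨U, hU, hx, h⟩ := hp x
      exact ⟨U, hU, hx, fun f hf hf' => h hf hf' i⟩

/-- The diffeology whose plots are the maps that become smooth after every one of the
functions `ob i`. -/
abbrev functionDiffeology {A ι V : Type*} [NormedAddCommGroup V] [NormedSpace ℝ V]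
    (ob : ι → A → V) : DiffeologicalSpace A where
  plots n := {p | ∀ i, ContDiff ℝ ∞ (fun u => ob i (p u))}
  constant_plots a i := contDiff_const
  plot_reparam hp hf i := (hp i).comp hf
  locality {n p} hp i := by
    have h : ContDiffOn ℝ ∞ (fun q : EuclideanSpace ℝ (Fin n) × ℝ => ob i (p q.1))
        (Set.univ ×ˢ Set.univ) := contDiffOn_of_local fun x => by
      obtain ⟨U, hU, hx, h⟩ := hp x
      exact ⟨U, hU, hx, fun f hf hf' => ((h hf hf' i).comp contDiff_fst).contDiffOn⟩
    rw [Set.univ_prod_univ, contDiffOn_univ] at h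
    exact h.comp (contDiff_id.prodMk (contDiff_const (c := (0 : ℝ))))

/-- The standard diffeology of the unit circle in `ℂ`. -/
instance : DiffeologicalSpace Circle := functionDiffeology (fun (_ : Unit) z => (z : ℂ))

/-- The discrete diffeology: plots are the locally constant maps. -/
abbrev discreteDiffeology (A : Type*) : DiffeologicalSpace A where
  plots n := {p | IsLocallyConstant p}
  constant_plots a := IsLocallyConstant.const a
  plot_reparam hp hf := hp.comp_continuous hf.continuous
  locality {n p} hp := by
    rw [Set.mem_ofPred_eq, IsLocallyConstant.iff_exists_open]
    intro x
    obtain ⟨U, hU, hx, h⟩ := hp x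
    obtain ⟨ε, hε, hεU⟩ := Metric.isOpen_iff.mp hU x hx
    set e := OpenPartialHomeomorph.univBall x ε with he
    have htgt : e.target = Metric.ball x ε := OpenPartialHomeomorph.univBall_target x hε
    have hmem : ∀ y, e y ∈ Metric.ball x ε := fun y => by
      rw [← htgt]
      exact e.map_source (by rw [he, OpenPartialHomeomorph.univBall_source]; trivial)
    have h1 : IsLocallyConstant (p ∘ e) :=
      h (fun y => hεU (hmem y)) OpenPartialHomeomorph.contDiff_univBall
    refine ⟨_, Metric.isOpen_ball, Metric.mem_ball_self hε, fun y hy => ?_⟩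
    rw [← e.right_inv (x := y) (by rwa [htgt]),
      ← e.right_inv (x := x) (by rw [htgt]; exact Metric.mem_ball_self hε)]
    exact h1.apply_eq_of_preconnectedSpace _ _

/-- A submersion: plots of the target lift locally through every point of the fibre. -/
def IsSubmersion {A B : Type*} [DiffeologicalSpace A] [DiffeologicalSpace B] (f : A → B) : Prop :=
  DSmooth f ∧ ∀ (n : ℕ) (q : EuclideanSpace ℝ (Fin n) → B), IsPlot q →
    ∀ (u : EuclideanSpace ℝ (Fin n)) (a : A), f a = q u →
      ∃ p : EuclideanSpace ℝ (Fin n) → A, IsPlot p ∧ p u = a ∧ ∀ᶠ v in nhds u, f (p v) = q v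

variable {H : Type*} {G : Type*} [Group H] [Group G] {H' : Type*} {G' : Type*} [Group H'] [Group G']
  {X : CrossedModule H G} {Y : CrossedModule H' G'}

/-- A monoidal functor between the categorical groups of two crossed modules is an equivalence of
categorical Lie groups if it is a monoidal equivalence of the underlying categories and a (weak)
equivalence of the underlying Lie groupoids `G ⇇ G × H`. -/
structure IsLieEquivalence [DiffeologicalSpace H] [DiffeologicalSpace G]
    [DiffeologicalSpace H'] [DiffeologicalSpace G']
    (F : TwoGroup X ⥤ TwoGroup Y) [F.Monoidal] : Prop where
  isEquivalence : F.IsEquivalence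
  smooth_obj : DSmooth (fun x : G => (F.obj ⟨x⟩).val)
  smooth_map : DSmooth (fun a : G × H => TwoGroup.label (F.map (TwoGroup.arrow X a.1 a.2)))
  smooth_tensor : DSmooth (fun a : G × G =>
    TwoGroup.label (Functor.LaxMonoidal.μ F (⟨a.1⟩ : TwoGroup X) ⟨a.2⟩))
  /-- Smooth essential surjectivity. -/
  submersion : IsSubmersion (fun a : G × H' => (F.obj ⟨a.1⟩).val * Y.bd a.2)
  /-- Smooth full faithfulness: the manifold of arrows of the source is the pullback of the
  manifold of arrows of the target along the map on objects. -/
  cartesian : ∀ (n : ℕ) (p : EuclideanSpace ℝ (Fin n) → G × H),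
    IsPlot (fun u => (p u).1) → IsPlot (fun u => (p u).1 * X.bd (p u).2) →
    IsPlot (fun u => TwoGroup.label (F.map (TwoGroup.arrow X (p u).1 (p u).2))) → IsPlot p

end Smooth

/-! ## Central extensions by the circle group -/

/-- A bimultiplicative map `A × A → U(1)`; it is a 2-cocycle. -/
structure Bichar (A : Type*) [AddCommGroup A] where
  toFun : A → A → Circle
  map_add_left : ∀ a b c, toFun (a + b) c = toFun a c * toFun b c
  map_add_right : ∀ a b c, toFun a (b + c) = toFun a b * toFun a c

/-- The central extension of `A` by `U(1)` with cocycle `c`: the set `U(1) × A` with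
multiplication `(z, a) (w, b) = (z w c(a, b), a + b)`. -/
@[ext]
structure CentralExt {A : Type*} [AddCommGroup A] (c : Bichar A) where
  z : Circle
  base : A

namespace CentralExt

variable {A : Type*} [AddCommGroup A] {c : Bichar A}

lemma zero_left (c : Bichar A) (a : A) : c.toFun 0 a = 1 := by
  simpa using c.map_add_left 0 0 a

lemma zero_right (c : Bichar A) (a : A) : c.toFun a 0 = 1 := by
  simpa using c.map_add_right a 0 0

lemma neg_left (c : Bichar A) (a b : A) : c.toFun (-a) b = (c.toFun a b)⁻¹ := by
  rw [eq_inv_iff_mul_eq_one, ← c.map_add_left, neg_add_cancel, zero_left]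

instance : Group (CentralExt c) where
  mul x y := ⟨x.z * y.z * c.toFun x.base y.base, x.base + y.base⟩
  one := ⟨1, 0⟩
  inv x := ⟨x.z⁻¹ * c.toFun x.base x.base, -x.base⟩
  mul_assoc x y w := by
    refine CentralExt.ext ?_ (add_assoc _ _ _)
    change x.z * y.z * c.toFun x.base y.base * w.z * c.toFun (x.base + y.base) w.base =
      x.z * (y.z * w.z * c.toFun y.base w.base) * c.toFun x.base (y.base + w.base)
    rw [c.map_add_left, c.map_add_right]
    simp only [mul_assoc, mul_comm, mul_left_comm]
  one_mul x := by
    refine CentralExt.ext ?_ (zero_add _)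
    change 1 * x.z * c.toFun 0 x.base = x.z
    rw [zero_left, mul_one, one_mul]
  mul_one x := by
    refine CentralExt.ext ?_ (add_zero _)
    change x.z * 1 * c.toFun x.base 0 = x.z
    rw [zero_right, mul_one, mul_one]
  inv_mul_cancel x := by
    refine CentralExt.ext ?_ (neg_add_cancel _)
    change x.z⁻¹ * c.toFun x.base x.base * x.z * c.toFun (-x.base) x.base = 1
    rw [neg_left, mul_right_comm x.z⁻¹, inv_mul_cancel, one_mul, mul_inv_cancel]

lemma mul_z (x y : CentralExt c) : (x * y).z = x.z * y.z * c.toFun x.base y.base := rfl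
lemma mul_base (x y : CentralExt c) : (x * y).base = x.base + y.base := rfl

/-- The crossed module `(z, a) ↦ ∂ a` with action `(z, a) ^ x = (e(x, a) z, a)`. -/
def crossedModule {B : Type*} [AddCommGroup B] (c : Bichar A) (d : A →+ B) (e : B → A → Circle)
    (he_left : ∀ x y a, e (x + y) a = e x a * e y a)
    (he_right : ∀ x a b, e x (a + b) = e x a * e x b)
    (he : ∀ a b, e (d a) b * c.toFun a b = c.toFun b a) :
    CrossedModule (CentralExt c) (Multiplicative B) where
  bd :=
    { toFun := fun h => Multiplicative.ofAdd (d h.base)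
      map_one' := congrArg Multiplicative.ofAdd (map_zero d)
      map_mul' := fun h k => congrArg Multiplicative.ofAdd (map_add d h.base k.base) }
  act x :=
    { toFun := fun h => ⟨e x.toAdd h.base * h.z, h.base⟩
      map_one' := CentralExt.ext (by
        change e x.toAdd 0 * 1 = 1
        simpa using he_right x.toAdd 0 0) rfl
      map_mul' := fun h k => CentralExt.ext (by
        change e x.toAdd (h.base + k.base) * (h.z * k.z * c.toFun h.base k.base) =
          (e x.toAdd h.base * h.z) * (e x.toAdd k.base * k.z) * c.toFun h.base k.base
        rw [he_right]
        simp only [mul_assoc, mul_comm, mul_left_comm]) rfl }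
  act_one h := CentralExt.ext (by
    change e 0 h.base * h.z = h.z
    have : e 0 h.base = 1 := by simpa using he_left 0 0 h.base
    rw [this, one_mul]) rfl
  act_mul x y h := CentralExt.ext (by
    change e (x.toAdd + y.toAdd) h.base * h.z = e y.toAdd h.base * (e x.toAdd h.base * h.z)
    rw [he_left]
    simp only [mul_assoc, mul_left_comm]) rfl
  bd_act x h := by
    change Multiplicative.ofAdd (d h.base) = x⁻¹ * Multiplicative.ofAdd (d h.base) * x
    rw [mul_comm x⁻¹, inv_mul_cancel_right]
  peiffer k h := by
    rw [mul_assoc, eq_inv_mul_iff_mul_eq]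
    refine CentralExt.ext ?_ (add_comm _ _)
    change k.z * (e (d k.base) h.base * h.z) * c.toFun k.base h.base =
      h.z * k.z * c.toFun h.base k.base
    rw [← he k.base h.base]
    simp only [mul_assoc, mul_left_comm]

/-- The smooth structure `U(1) × A` on a central extension. -/
abbrev diffeology (d : DiffeologicalSpace A) : DiffeologicalSpace (CentralExt c) :=
  inducedDiffeology (fun h : CentralExt c => (h.z, h.base))

end CentralExt

section Torus

variable {Λ : Type u} [AddCommGroup Λ]

/-- The group homomorphism `ℝ → U(1)`, `r ↦ exp (2 π i r)`. -/
def expU : ℝ →+ Additive Circle where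
  toFun r := Additive.ofMul (Circle.exp (2 * Real.pi * r))
  map_zero' := by simp
  map_add' r s := by rw [mul_add, Circle.exp_add, ofMul_mul]

variable (Λ) in
/-- The Lie algebra `𝔱 = ℝ ⊗ Λ`. -/
abbrev LieAlg : Type u := ℝ ⊗[ℤ] Λ

variable (Λ) in
/-- The torus `T = U(1) ⊗ Λ` (written additively). -/
abbrev Torus : Type u := Additive Circle ⊗[ℤ] Λ

variable (Λ) in
/-- The exponential map `exp : 𝔱 → T`. -/
def expT : LieAlg Λ →+ Torus Λ := (expU.toIntLinearMap.rTensor Λ).toAddMonoidHom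

/-- The homomorphism `A ⊗ Λ → A` induced by a linear form `χ` on `Λ`: for `A = ℝ` a linear
coordinate of `𝔱`, for `A = U(1)` a character of `T`. -/
def ev {A : Type*} [AddCommGroup A] (χ : Module.Dual ℤ Λ) : A ⊗[ℤ] Λ →+ A :=
  ((TensorProduct.rid ℤ A).toLinearMap ∘ₗ χ.lTensor A).toAddMonoidHom

/-- The inclusion `Λ → 𝔱`. -/
def inclLat : Λ →+ LieAlg Λ := (TensorProduct.mk ℤ ℝ Λ 1).toAddMonoidHom

/-- The extension to `𝔱` of an integral bilinear form on `Λ`. -/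
def realForm (B : LinearMap.BilinForm ℤ Λ) : LinearMap.BilinForm ℝ (LieAlg Λ) :=
  LinearMap.BilinForm.baseChange ℝ B

/-- The even symmetric form `I(m, n) = J(m, n) + J(n, m)`. -/
def symForm (J : LinearMap.BilinForm ℤ Λ) : LinearMap.BilinForm ℤ Λ := J + J.flip

/-- `γ`, defined on `[0, 1]`, as a function on `ℝ` that is constant outside `[0, 1]`. -/
abbrev ext01 {A : Type*} (γ : unitInterval → A) : ℝ → A := Set.IccExtend zero_le_one γ

/-- Smoothness of a path `[0, 1] → 𝔱`, tested with the linear coordinates. -/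
def IsSmoothInLieAlg (f : unitInterval → LieAlg Λ) : Prop :=
  ∀ χ : Module.Dual ℤ Λ, ContDiffOn ℝ ∞ (fun s => ev χ (ext01 f s)) (Set.Icc 0 1)

/-- Smoothness of a path `[0, 1] → T`, tested with the characters of `T`. -/
def IsSmoothInTorus (γ : unitInterval → Torus Λ) : Prop :=
  ∀ χ : Module.Dual ℤ Λ,
    ContDiffOn ℝ ∞ (fun s => ((ev χ (ext01 γ s)).toMul : ℂ)) (Set.Icc 0 1)

variable (Λ) in
/-- The group `P₁T` of smooth paths `[0, 1] → T` that start at the unit. -/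
def PathGroup : AddSubgroup (unitInterval → Torus Λ) where
  carrier := {γ | IsSmoothInTorus γ ∧ γ 0 = 0}
  zero_mem' := ⟨fun χ => by
    have : (fun s => ((ev χ (ext01 (0 : unitInterval → Torus Λ) s)).toMul : ℂ)) = fun _ => 1 := by
      funext s; simp [ext01, Set.IccExtend]
    rw [this]; exact contDiffOn_const, rfl⟩
  add_mem' {γ δ} h k := ⟨fun χ => by
    have := (h.1 χ).mul (k.1 χ)
    refine this.congr fun s _ => ?_
    simp [ext01, Set.IccExtend], by simp [h.2, k.2]⟩
  neg_mem' {γ} h := ⟨fun χ => by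
    have := (Complex.conjCLE.contDiff (n := ∞)).comp_contDiffOn (h.1 χ)
    refine this.congr fun s _ => ?_
    change (((ev χ (-(ext01 γ s))).toMul : Circle) : ℂ) = (starRingEnd ℂ) _
    rw [map_neg, toMul_neg, Circle.coe_inv_eq_conj], by simp [h.2]⟩

/-- Smooth paths `[0, 1] → T` as functions. -/
instance : CoeFun (PathGroup Λ) (fun _ => unitInterval → Torus Λ) := ⟨fun γ => γ.1⟩

variable (Λ) in
/-- The group `ΩT` of smooth loops at the unit: the closed paths in `P₁T`. -/
def LoopGroup : AddSubgroup (PathGroup Λ) where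
  carrier := {γ | γ 1 = 0}
  zero_mem' := rfl
  add_mem' {γ δ} h k := by
    change γ 1 + δ 1 = 0
    rw [h, k, add_zero]
  neg_mem' {γ} h := by
    change -(γ 1) = 0
    rw [h, neg_zero]

/-- `f` is the lift of `γ` along `exp : 𝔱 → T` that starts at `0`. -/
structure IsLift (γ : PathGroup Λ) (f : unitInterval → LieAlg Λ) : Prop where
  smooth : IsSmoothInLieAlg f
  zero : f 0 = 0
  exp : ∀ s, expT Λ (f s) = γ s

/-! ### Existence and uniqueness of lifts -/

@[simp] lemma ev_tmul {A : Type*} [AddCommGroup A] (χ : Module.Dual ℤ Λ) (a : A) (m : Λ) :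
    ev χ (a ⊗ₜ[ℤ] m) = χ m • a := by
  simp [ev]

lemma ev_smul (χ : Module.Dual ℤ Λ) (r : ℝ) (x : LieAlg Λ) : ev χ (r • x) = r * ev χ x := by
  induction x using TensorProduct.induction_on with
  | zero => simp
  | tmul a m => simp [TensorProduct.smul_tmul']; ring
  | add x y hx hy => rw [smul_add, map_add, hx, hy, map_add, mul_add]

lemma ev_expT (χ : Module.Dual ℤ Λ) (x : LieAlg Λ) : ev χ (expT Λ x) = expU (ev χ x) := by
  induction x using TensorProduct.induction_on with
  | zero => simp
  | tmul a m =>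
    change ev χ (expU a ⊗ₜ[ℤ] m) = _
    rw [ev_tmul, ev_tmul, map_zsmul]
  | add x y hx hy => rw [map_add, map_add, hx, hy, map_add, map_add]

lemma sum_ev {ι A : Type*} [Fintype ι] [AddCommGroup A] (b : Module.Basis ι ℤ Λ)
    (x : A ⊗[ℤ] Λ) : ∑ i, ev (b.coord i) x ⊗ₜ[ℤ] b i = x := by
  induction x using TensorProduct.induction_on with
  | zero => simp
  | tmul a m =>
    simp only [ev_tmul, TensorProduct.smul_tmul, ← TensorProduct.tmul_sum]
    simp [b.sum_repr]
  | add x y hx hy =>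
    simp only [map_add, TensorProduct.add_tmul, Finset.sum_add_distrib, hx, hy]

lemma realForm_apply {ι : Type*} [Fintype ι] (b : Module.Basis ι ℤ Λ)
    (B : LinearMap.BilinForm ℤ Λ) (x y : LieAlg Λ) :
    realForm B x y = ∑ i, ev (b.coord i) x * ev (B (b i)) y := by
  have key : ∀ (a : ℝ) (m : Λ), realForm B (a ⊗ₜ m) y = a * ev (B m) y := by
    intro a m
    induction y using TensorProduct.induction_on with
    | zero => simp
    | tmul c n => simp [realForm]; ring
    | add y z hy hz => rw [map_add, hy, hz, map_add, mul_add]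
  conv_lhs => rw [← sum_ev b x]
  rw [map_sum, LinearMap.sum_apply]
  exact Finset.sum_congr rfl fun i _ => key _ _

lemma expU_eq_zero {r : ℝ} : expU r = 0 ↔ ∃ n : ℤ, r = n := by
  change Additive.ofMul (Circle.exp (2 * Real.pi * r)) = 0 ↔ _
  rw [ofMul_eq_zero, Circle.exp_eq_one]
  refine exists_congr fun n => ⟨fun h => ?_, fun h => by rw [h]; ring⟩
  have : (2 * Real.pi) ≠ 0 := by positivity
  exact mul_left_cancel₀ this (by rw [h]; ring)

lemma eq_zero_of_int_valued {h : ℝ → ℝ} (hc : ContinuousOn h (Set.Icc 0 1)) (h0 : h 0 = 0)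
    (hint : ∀ s ∈ Set.Icc (0 : ℝ) 1, ∃ n : ℤ, h s = n) {s : ℝ} (hs : s ∈ Set.Icc (0 : ℝ) 1) :
    h s = 0 := by
  rw [← h0]
  refine isPreconnected_Icc.constant_of_mapsTo (T := Set.range ((↑) : ℤ → ℝ)) ?_ hc ?_ hs
    (Set.left_mem_Icc.mpr zero_le_one)
  · exact Int.isClosedEmbedding_coe_real.isEmbedding.isDiscrete_range
  · intro s hs
    obtain ⟨n, hn⟩ := hint s hs
    exact ⟨n, hn.symm⟩

/-- Smooth maps `[0, 1] → U(1)` starting at `1` have smooth logarithms. -/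
lemma exists_log {u : ℝ → Circle} (hu : ContDiffOn ℝ ∞ (fun s => (u s : ℂ)) (Set.Icc 0 1))
    (h0 : u 0 = 1) : ∃ f : ℝ → ℝ, ContDiffOn ℝ ∞ f (Set.Icc 0 1) ∧ f 0 = 0 ∧
      ∀ s ∈ Set.Icc (0 : ℝ) 1, expU (f s) = Additive.ofMul (u s) := by
  have hI : UniqueDiffOn ℝ (Set.Icc (0 : ℝ) 1) := uniqueDiffOn_Icc zero_lt_one
  set v := derivWithin (fun s => (u s : ℂ)) (Set.Icc 0 1) with hv
  obtain ⟨hud, hvs⟩ := (contDiffOn_infty_iff_derivWithin hI).mp hu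
  have hw0 : ContDiffOn ℝ ∞
      (fun s => v s * (starRingEnd ℂ) (u s : ℂ)) (Set.Icc 0 1) :=
    hvs.mul ((Complex.conjCLE.contDiff (n := ∞)).comp_contDiffOn hu)
  set w : ℝ → ℂ := fun s => v s * (starRingEnd ℂ) (u s : ℂ) with hw
  set w' : ℝ → ℂ := Set.IccExtend (zero_le_one (α := ℝ)) (fun s : Set.Icc (0 : ℝ) 1 => w s)
    with hw'
  have hw'c : Continuous w' := (continuousOn_iff_continuous_domRestrict.mp hw0.continuousOn).Icc_extend'
  have hww' : ∀ s ∈ Set.Icc (0 : ℝ) 1, w' s = w s := fun s hs => Set.IccExtend_of_mem _ _ hs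
  set F : ℝ → ℂ := fun s => ∫ r in (0 : ℝ)..s, w' r with hF
  have hFd : ∀ s, HasDerivAt F (w' s) s := fun s => (hw'c.integral_hasStrictDerivAt 0 s).hasDerivAt
  have hFs : ContDiffOn ℝ ∞ F (Set.Icc 0 1) := by
    rw [contDiffOn_infty_iff_derivWithin hI]
    refine ⟨fun s _ => (hFd s).differentiableAt.differentiableWithinAt, hw0.congr fun s hs => ?_⟩
    rw [(hFd s).hasDerivWithinAt.derivWithin (hI s hs), hww' s hs]
  have hF0 : F 0 = 0 := by simp [hF]
  have hunit : ∀ s, (u s : ℂ) * (starRingEnd ℂ) (u s : ℂ) = 1 := fun s => by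
    rw [Complex.mul_conj, Circle.normSq_coe, Complex.ofReal_one]
  have hconst : ∀ s ∈ Set.Icc (0 : ℝ) 1, Complex.exp (-F s) * u s = 1 := by
    have hder : ∀ s ∈ Set.Icc (0 : ℝ) 1, HasDerivWithinAt (fun s => Complex.exp (-F s) * (u s : ℂ))
        0 (Set.Icc 0 1) s := fun s hs => by
      have h1 := ((hFd s).neg.cexp).hasDerivWithinAt (s := Set.Icc (0 : ℝ) 1)
      have h2 := (hud s hs).hasDerivWithinAt
      refine (h1.mul h2).congr_deriv (Eq.symm ?_)
      rw [hww' s hs]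
      change 0 = Complex.exp (-F s) * -(v s * (starRingEnd ℂ) (u s : ℂ)) * (u s : ℂ)
        + Complex.exp (-F s) * v s
      linear_combination (Complex.exp (-F s) * v s) * hunit s
    intro s hs
    have := constant_of_derivWithin_zero (f := fun s => Complex.exp (-F s) * (u s : ℂ))
      (a := 0) (b := 1) (fun s hs => (hder s hs).differentiableWithinAt)
      (fun s hs => (hder s (Set.Ico_subset_Icc_self hs)).derivWithin
        (hI s (Set.Ico_subset_Icc_self hs))) s hs
    rw [this]
    simp [hF0, h0]
  have huF : ∀ s ∈ Set.Icc (0 : ℝ) 1, (u s : ℂ) = Complex.exp (F s) := fun s hs => by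
    have := hconst s hs
    rw [Complex.exp_neg] at this
    exact ((inv_mul_eq_one₀ (Complex.exp_ne_zero _)).mp this).symm
  have hre : ∀ s ∈ Set.Icc (0 : ℝ) 1, (F s).re = 0 := fun s hs => by
    have h1 : ‖(u s : ℂ)‖ = 1 := Circle.norm_coe _
    rw [huF s hs, Complex.norm_exp] at h1
    simpa using h1
  refine ⟨fun s => (2 * Real.pi)⁻¹ * (F s).im,
    contDiffOn_const.mul ((Complex.imCLM.contDiff (n := ∞)).comp_contDiffOn hFs),
    by simp [hF0], fun s hs => ?_⟩
  change Additive.ofMul (Circle.exp (2 * Real.pi * ((2 * Real.pi)⁻¹ * (F s).im))) = _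
  congr 1
  apply Subtype.ext
  rw [mul_inv_cancel_left₀ (by positivity), Circle.coe_exp, huF s hs]
  congr 1
  apply Complex.ext <;> simp [hre s hs]

/-! ### The integral `∫₀¹ B(f(t), ġ(t)) dt` -/

/-- `∫₀¹ B(f(t), ġ(t)) dt`, the integrand being the derivative at `r = t` of `B(f(t), g(r))`. -/
def pairing (B : LinearMap.BilinForm ℤ Λ) (f g : unitInterval → LieAlg Λ) : ℝ :=
  ∫ t in (0 : ℝ)..1, deriv (fun r => realForm B (ext01 f t) (ext01 g r)) t

lemma hasDerivAt_of_smooth {v : ℝ → ℝ} (hv : ContDiffOn ℝ ∞ v (Set.Icc 0 1)) {s : ℝ}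
    (hs : s ∈ Set.Ioo (0 : ℝ) 1) : HasDerivAt v (deriv v s) s :=
  ((hv.differentiableOn (by simp) s (Set.Ioo_subset_Icc_self hs)).differentiableAt
    (Icc_mem_nhds hs.1 hs.2)).hasDerivAt

lemma intervalIntegrable_mul_deriv {p v : ℝ → ℝ} (hp : ContDiffOn ℝ ∞ p (Set.Icc 0 1))
    (hv : ContDiffOn ℝ ∞ v (Set.Icc 0 1)) :
    IntervalIntegrable (fun s => p s * deriv v s) MeasureTheory.volume 0 1 := by
  have h : ContinuousOn (fun s => p s * derivWithin v (Set.Icc 0 1) s) (Set.Icc 0 1) :=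
    hp.continuousOn.mul
      ((contDiffOn_infty_iff_derivWithin (uniqueDiffOn_Icc zero_lt_one)).mp hv).2.continuousOn
  refine IntervalIntegrable.congr_uIoo (h.intervalIntegrable_of_Icc zero_le_one) ?_
  intro s hs
  rw [Set.uIoo_of_le zero_le_one] at hs
  simp only [derivWithin_of_mem_nhds (Icc_mem_nhds hs.1 hs.2)]

lemma pairing_eq {ι : Type*} [Fintype ι] (b : Module.Basis ι ℤ Λ) (B : LinearMap.BilinForm ℤ Λ)
    {f g : unitInterval → LieAlg Λ} (hf : IsSmoothInLieAlg f) (hg : IsSmoothInLieAlg g) :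
    pairing B f g = ∑ i, ∫ t in (0 : ℝ)..1,
      ev (b.coord i) (ext01 f t) * deriv (fun r => ev (B (b i)) (ext01 g r)) t := by
  rw [← intervalIntegral.integral_finsetSum fun i _ => intervalIntegrable_mul_deriv (hf _) (hg _)]
  refine intervalIntegral.integral_congr_Ioo_of_le zero_le_one fun t ht => ?_
  simp only [realForm_apply b]
  exact (HasDerivAt.fun_sum fun i _ => (hasDerivAt_of_smooth (hg (B (b i))) ht).const_mul _).deriv

lemma realForm_inclLat (B : LinearMap.BilinForm ℤ Λ) (m n : Λ) :
    realForm B (inclLat m) (inclLat n) = B m n := by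
  simp [realForm, inclLat]

lemma symForm_apply (J : LinearMap.BilinForm ℤ Λ) (m n : Λ) : symForm J m n = J m n + J n m := by
  simp [symForm, LinearMap.BilinForm.flip_apply]

variable [Module.Free ℤ Λ] [Module.Finite ℤ Λ]

lemma ev_ext {A : Type*} [AddCommGroup A] {x y : A ⊗[ℤ] Λ}
    (h : ∀ χ : Module.Dual ℤ Λ, ev χ x = ev χ y) : x = y := by
  rw [← sum_ev (Module.Free.chooseBasis ℤ Λ) x, ← sum_ev (Module.Free.chooseBasis ℤ Λ) y]
  simp only [h]

lemma IsLift.unique {γ : PathGroup Λ} {f g : unitInterval → LieAlg Λ} (hf : IsLift γ f)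
    (hg : IsLift γ g) : f = g := by
  funext s
  refine ev_ext fun χ => ?_
  have := eq_zero_of_int_valued (h := fun s => ev χ (ext01 f s) - ev χ (ext01 g s))
    ((hf.smooth χ).continuousOn.sub (hg.smooth χ).continuousOn)
    (by simp [ext01, hf.zero, hg.zero, Set.IccExtend]) (fun s hs => by
      rw [← expU_eq_zero, map_sub, ← ev_expT, ← ev_expT]
      change ev χ (expT Λ (f _)) - ev χ (expT Λ (g _)) = 0
      rw [hf.exp, hg.exp, sub_self]) s.2
  simpa [ext01, sub_eq_zero] using this

lemma exists_isLift (γ : PathGroup Λ) : ∃ f, IsLift γ f := by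
  let b := Module.Free.chooseBasis ℤ Λ
  have h : ∀ i, ∃ f : ℝ → ℝ, ContDiffOn ℝ ∞ f (Set.Icc 0 1) ∧ f 0 = 0 ∧
      ∀ s ∈ Set.Icc (0 : ℝ) 1, expU (f s) = ev (b.coord i) (ext01 γ.1 s) := fun i =>
    exists_log (u := fun s => (ev (b.coord i) (ext01 γ.1 s)).toMul) (γ.2.1 (b.coord i)) (by
      have h0 : ext01 γ.1 0 = 0 := by
        rw [ext01, Set.IccExtend_left]
        exact γ.2.2
      simp only [h0, map_zero, toMul_zero])
  choose f hf hf0 hfe using h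
  refine ⟨fun s => ∑ i, f i s ⊗ₜ[ℤ] b i, fun χ => ?_, ?_, fun s => ?_⟩
  · have : ContDiffOn ℝ ∞ (fun s => ∑ i, χ (b i) • f i s) (Set.Icc 0 1) :=
      ContDiffOn.sum fun i _ => by
        simpa only [zsmul_eq_mul] using contDiffOn_const.mul (hf i)
    refine this.congr fun s hs => ?_
    simp [ext01, Set.IccExtend_of_mem _ _ hs]
  · simp [hf0]
  · rw [← sum_ev b (γ s), map_sum]
    refine Finset.sum_congr rfl fun i _ => ?_
    have := hfe i s s.2
    rw [ext01, Set.IccExtend_val] at this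
    rw [← this]
    simp [expT]

/-- The lift of a path to `𝔱` that starts at `0`. -/
def lift (γ : PathGroup Λ) : unitInterval → LieAlg Λ := (exists_isLift γ).choose

lemma lift_spec (γ : PathGroup Λ) : IsLift γ (lift γ) := (exists_isLift γ).choose_spec

lemma lift_add (γ δ : PathGroup Λ) : lift (γ + δ) = lift γ + lift δ := by
  refine (lift_spec _).unique ⟨fun χ => ?_, ?_, fun s => ?_⟩
  · refine (((lift_spec γ).smooth χ).add ((lift_spec δ).smooth χ)).congr fun s _ => ?_
    simp [ext01, Set.IccExtend]
  · simp [(lift_spec γ).zero, (lift_spec δ).zero]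
  · simp [(lift_spec γ).exp, (lift_spec δ).exp]

lemma lift_one_integral (γ : LoopGroup Λ) (χ : Module.Dual ℤ Λ) :
    ∃ n : ℤ, ev χ (lift γ.1 1) = n := by
  rw [← expU_eq_zero, ← ev_expT, (lift_spec γ.1).exp]
  have h : γ.1 1 = 0 := γ.2
  rw [h, map_zero]

lemma pairing_add_left (B : LinearMap.BilinForm ℤ Λ) {f f' g : unitInterval → LieAlg Λ}
    (hf : IsSmoothInLieAlg f) (hf' : IsSmoothInLieAlg f') (hg : IsSmoothInLieAlg g)
    (hs : IsSmoothInLieAlg (f + f')) :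
    pairing B (f + f') g = pairing B f g + pairing B f' g := by
  let b := Module.Free.chooseBasis ℤ Λ
  rw [pairing_eq b B hs hg, pairing_eq b B hf hg, pairing_eq b B hf' hg, ← Finset.sum_add_distrib]
  refine Finset.sum_congr rfl fun i _ => ?_
  rw [← intervalIntegral.integral_add (intervalIntegrable_mul_deriv (hf _) (hg _))
    (intervalIntegrable_mul_deriv (hf' _) (hg _))]
  simp [ext01, Set.IccExtend, add_mul]

lemma pairing_add_right (B : LinearMap.BilinForm ℤ Λ) {f g g' : unitInterval → LieAlg Λ}
    (hf : IsSmoothInLieAlg f) (hg : IsSmoothInLieAlg g) (hg' : IsSmoothInLieAlg g')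
    (hs : IsSmoothInLieAlg (g + g')) :
    pairing B f (g + g') = pairing B f g + pairing B f g' := by
  let b := Module.Free.chooseBasis ℤ Λ
  rw [pairing_eq b B hf hs, pairing_eq b B hf hg, pairing_eq b B hf hg', ← Finset.sum_add_distrib]
  refine Finset.sum_congr rfl fun i _ => ?_
  rw [← intervalIntegral.integral_add (intervalIntegrable_mul_deriv (hf _) (hg _))
    (intervalIntegrable_mul_deriv (hf _) (hg' _))]
  refine intervalIntegral.integral_congr_Ioo_of_le zero_le_one fun t ht => ?_
  have h : (fun r => ev (B (b i)) (ext01 (g + g') r)) =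
      fun r => ev (B (b i)) (ext01 g r) + ev (B (b i)) (ext01 g' r) := by
    funext r
    simp [ext01, Set.IccExtend]
  simp only [h, ← mul_add]
  rw [((hasDerivAt_of_smooth (hg _) ht).fun_add (hasDerivAt_of_smooth (hg' _) ht)).deriv]

/-- Integration by parts. -/
lemma pairing_symForm (J : LinearMap.BilinForm ℤ Λ) {f g : unitInterval → LieAlg Λ}
    (hf : IsSmoothInLieAlg f) (hg : IsSmoothInLieAlg g) (hf0 : f 0 = 0) :
    pairing (symForm J) f g + pairing J g f = pairing J f g + realForm J (g 1) (f 1) := by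
  let b := Module.Free.chooseBasis ℤ Λ
  have hJ : ∀ t r, realForm J (ext01 g t) (ext01 f r) =
      ∑ i, ev (b.coord i) (ext01 g t) * ev (J (b i)) (ext01 f r) := fun t r =>
    realForm_apply b J _ _
  have hflip : ∀ x y : LieAlg Λ, realForm (symForm J) x y = realForm J x y + realForm J y x := by
    intro x y
    induction x using TensorProduct.induction_on with
    | zero => simp
    | tmul a m =>
      induction y using TensorProduct.induction_on with
      | zero => simp
      | tmul c n =>
        simp only [realForm, symForm, LinearMap.BilinForm.baseChange_tmul, LinearMap.add_apply,
          LinearMap.BilinForm.flip_apply, zsmul_eq_mul, Int.cast_add]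
        ring
      | add y z hy hz =>
        simp only [map_add, LinearMap.add_apply, hy, hz]
        ring
    | add x z hx hz =>
      simp only [map_add, LinearMap.add_apply, hx, hz]
      ring
  have hdiff : ∀ (B : LinearMap.BilinForm ℤ Λ) {p q : unitInterval → LieAlg Λ},
      IsSmoothInLieAlg q → ∀ t ∈ Set.Ioo (0 : ℝ) 1,
      HasDerivAt (fun r => realForm B (ext01 p t) (ext01 q r))
        (∑ i, ev (b.coord i) (ext01 p t) * deriv (fun r => ev (B (b i)) (ext01 q r)) t) t := by
    intro B p q hq t ht
    simp only [realForm_apply b]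
    exact HasDerivAt.fun_sum fun i _ => (hasDerivAt_of_smooth (hq (B (b i))) ht).const_mul _
  have hint : ∀ (B : LinearMap.BilinForm ℤ Λ) {p q : unitInterval → LieAlg Λ},
      IsSmoothInLieAlg p → IsSmoothInLieAlg q →
      IntervalIntegrable (fun t => deriv (fun r => realForm B (ext01 p t) (ext01 q r)) t)
        MeasureTheory.volume 0 1 := by
    intro B p q hp hq
    refine IntervalIntegrable.congr_uIoo (f := fun t => ∑ i, ev (b.coord i) (ext01 p t) *
      deriv (fun r => ev (B (b i)) (ext01 q r)) t) ?_ ?_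
    · have := IntervalIntegrable.sum Finset.univ fun i _ =>
        intervalIntegrable_mul_deriv (hp (b.coord i)) (hq (B (b i)))
      exact this.congr fun t _ => Finset.sum_apply _ _ _
    · intro t ht
      rw [Set.uIoo_of_le zero_le_one] at ht
      exact (hdiff B hq t ht).deriv.symm
  have hsecond : ∀ t ∈ Set.Ioo (0 : ℝ) 1,
      HasDerivAt (fun r => realForm J (ext01 g r) (ext01 f t))
        (∑ i, deriv (fun r => ev (b.coord i) (ext01 g r)) t * ev (J (b i)) (ext01 f t)) t := by
    intro t ht
    simp only [realForm_apply b]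
    exact HasDerivAt.fun_sum fun i _ => (hasDerivAt_of_smooth (hg _) ht).mul_const _
  have hprod : ∀ t ∈ Set.Ioo (0 : ℝ) 1,
      HasDerivAt (fun r => realForm J (ext01 g r) (ext01 f r))
        (deriv (fun r => realForm J (ext01 g r) (ext01 f t)) t +
          deriv (fun r => realForm J (ext01 g t) (ext01 f r)) t) t := by
    intro t ht
    rw [(hsecond t ht).deriv, (hdiff J hf t ht).deriv, ← Finset.sum_add_distrib]
    simp only [realForm_apply b]
    exact HasDerivAt.fun_sum fun i _ =>
      (hasDerivAt_of_smooth (hg _) ht).mul (hasDerivAt_of_smooth (hf _) ht)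
  have hsym : ∀ t ∈ Set.Ioo (0 : ℝ) 1,
      deriv (fun r => realForm (symForm J) (ext01 f t) (ext01 g r)) t =
        deriv (fun r => realForm J (ext01 f t) (ext01 g r)) t +
        deriv (fun r => realForm J (ext01 g r) (ext01 f t)) t := by
    intro t ht
    simp only [hflip]
    rw [(hdiff J hg t ht).deriv, (hsecond t ht).deriv]
    exact ((hdiff J hg t ht).add (hsecond t ht)).deriv
  have hcont : ContinuousOn (fun r => realForm J (ext01 g r) (ext01 f r)) (Set.Icc 0 1) := by
    simp only [realForm_apply b]
    exact continuousOn_finsetSum _ fun i _ => (hg _).continuousOn.mul (hf _).continuousOn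
  have hIS : pairing (symForm J) f g + pairing J g f - pairing J f g =
      ∫ t in (0 : ℝ)..1, (deriv (fun r => realForm J (ext01 g r) (ext01 f t)) t +
          deriv (fun r => realForm J (ext01 g t) (ext01 f r)) t) := by
    rw [pairing, pairing, pairing, ← intervalIntegral.integral_add (hint _ hf hg) (hint _ hg hf),
      ← intervalIntegral.integral_sub ((hint _ hf hg).add (hint _ hg hf)) (hint _ hf hg)]
    refine intervalIntegral.integral_congr_Ioo_of_le zero_le_one fun t ht => ?_
    simp only [hsym t ht]
    ring
  have hii : IntervalIntegrable (fun t => deriv (fun r => realForm J (ext01 g r) (ext01 f t)) t +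
      deriv (fun r => realForm J (ext01 g t) (ext01 f r)) t) MeasureTheory.volume 0 1 := by
    refine IntervalIntegrable.congr_uIoo
      (((hint (symForm J) hf hg).sub (hint J hf hg)).add (hint J hg hf)) ?_
    intro t ht
    rw [Set.uIoo_of_le zero_le_one] at ht
    simp only [hsym t ht]
    ring
  rw [intervalIntegral.integral_eq_sub_of_hasDerivAt_of_le zero_le_one hcont hprod hii] at hIS
  have e1 : ∀ p : unitInterval → LieAlg Λ, ext01 p 1 = p 1 := fun p => Set.IccExtend_right _ _
  have e0 : ∀ p : unitInterval → LieAlg Λ, ext01 p 0 = p 0 := fun p => Set.IccExtend_left _ _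
  rw [e1, e1, e0, e0, hf0, map_zero, sub_zero] at hIS
  linarith

/-! ### The cocycles and the crossed modules -/

/-- `exp(r) = e ^ (2 π i r)` as an element of `U(1)`. -/
def expC (r : ℝ) : Circle := (expU r).toMul

lemma expC_add (r s : ℝ) : expC (r + s) = expC r * expC s := by simp [expC]

lemma expC_int (n : ℤ) : expC n = 1 := by
  have : expU (n : ℝ) = 0 := expU_eq_zero.mpr ⟨n, rfl⟩
  rw [expC, this, toMul_zero]

/-- The cocycle `(m, n) ↦ (-1) ^ J(m, n)` on `Λ`. -/
def signBichar (J : LinearMap.BilinForm ℤ Λ) : Bichar Λ where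
  toFun m n := (-1) ^ (J m n)
  map_add_left a b c := by rw [map_add, LinearMap.add_apply, zpow_add]
  map_add_right a b c := by rw [map_add, zpow_add]

variable (Λ) in
/-- The trivial cocycle on `Λ`; the corresponding extension is the product `U(1) × Λ`. -/
def trivialBichar : Bichar Λ where
  toFun _ _ := 1
  map_add_left _ _ _ := (one_mul 1).symm
  map_add_right _ _ _ := (one_mul 1).symm

/-- The cocycle `c(φ, γ) = exp(∫₀¹ J(f(t), ġ(t)) dt)` on `ΩT`, where `f`, `g` lift `φ`, `γ`. -/
def cocycle (J : LinearMap.BilinForm ℤ Λ) (φ γ : LoopGroup Λ) : Circle :=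
  expC (pairing J (lift φ.1) (lift γ.1))

lemma pairing_lift_add_left (B : LinearMap.BilinForm ℤ Λ) (φ ψ γ : PathGroup Λ) :
    pairing B (lift (φ + ψ)) (lift γ) =
      pairing B (lift φ) (lift γ) + pairing B (lift ψ) (lift γ) := by
  have h := (lift_spec (φ + ψ)).smooth
  rw [lift_add] at h ⊢
  exact pairing_add_left B (lift_spec φ).smooth (lift_spec ψ).smooth (lift_spec γ).smooth h

lemma pairing_lift_add_right (B : LinearMap.BilinForm ℤ Λ) (φ γ δ : PathGroup Λ) :
    pairing B (lift φ) (lift (γ + δ)) =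
      pairing B (lift φ) (lift γ) + pairing B (lift φ) (lift δ) := by
  have h := (lift_spec (γ + δ)).smooth
  rw [lift_add] at h ⊢
  exact pairing_add_right B (lift_spec φ).smooth (lift_spec γ).smooth (lift_spec δ).smooth h

/-- The inverse cocycle `c⁻¹` on `ΩT`. -/
def loopBichar (J : LinearMap.BilinForm ℤ Λ) : Bichar (LoopGroup Λ) where
  toFun φ γ := (cocycle J φ γ)⁻¹
  map_add_left φ ψ γ := by
    rw [← mul_inv, cocycle, cocycle, cocycle, ← expC_add, ← pairing_lift_add_left]
    rfl
  map_add_right φ γ δ := by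
    rw [← mul_inv, cocycle, cocycle, cocycle, ← expC_add, ← pairing_lift_add_right]
    rfl

lemma expC_half_int (n : ℤ) : expC ((n : ℝ) / 2) = (-1) ^ n := by
  have h1 : expC (1 / 2) = -1 := by
    apply Subtype.ext
    change ((Circle.exp (2 * Real.pi * (1 / 2)) : Circle) : ℂ) = ((-1 : Circle) : ℂ)
    rw [show 2 * Real.pi * (1 / 2) = Real.pi by ring, Circle.coe_exp, Complex.exp_pi_mul_I]
    rfl
  rw [← h1, expC, expC, ← toMul_zsmul, ← map_zsmul]
  congr 2
  simp [div_eq_mul_inv]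

/-- The crossed module `Ψ : U(1) × Λ → 𝔱`, `(z, m) ↦ m`, with `(z, m) ^ x = (z exp(J(m, x)), m)`. -/
def strictCM (J : LinearMap.BilinForm ℤ Λ) :
    CrossedModule (CentralExt (trivialBichar Λ)) (Multiplicative (LieAlg Λ)) :=
  CentralExt.crossedModule (trivialBichar Λ) inclLat (fun x m => expC (realForm J (inclLat m) x))
    (fun x y m => by rw [map_add, expC_add])
    (fun x m n => by rw [map_add, map_add, LinearMap.add_apply, expC_add])
    (fun m n => by rw [realForm_inclLat, expC_int]; exact one_mul 1)

/-- The crossed module `Ξ : Λ~ → 𝔱`, `(z, m) ↦ m`, where `Λ~` is the central extension of `Λ` by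
`U(1)` with cocycle `(-1) ^ J`, with the action `(z, m) ^ x = (z exp(I(x, m) / 2), m)`. -/
def latticeCM (J : LinearMap.BilinForm ℤ Λ) :
    CrossedModule (CentralExt (signBichar J)) (Multiplicative (LieAlg Λ)) :=
  CentralExt.crossedModule (signBichar J) inclLat
    (fun x m => expC (realForm (symForm J) x (inclLat m) / 2))
    (fun x y m => by rw [map_add, LinearMap.add_apply, add_div, expC_add])
    (fun x m n => by rw [map_add, map_add, add_div, expC_add])
    (fun m n => by
      rw [realForm_inclLat, expC_half_int, symForm_apply]
      change (-1) ^ (J m n + J n m) * (-1 : Circle) ^ (J m n) = (-1) ^ (J n m)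
      rw [zpow_add, mul_right_comm, ← mul_zpow]
      simp)

/-- The crossed module `Π : ΩT~ → P₁T`, `(z, γ) ↦ γ`, where `ΩT~` is the central extension of `ΩT`
by `U(1)` with cocycle `c⁻¹`, with the action `(z, γ) ^ φ = (e z, γ)`,
`e = exp(∫₀¹ I(f(t), ġ(t)) dt)`, where `f`, `g` are the lifts of `φ`, `γ` that start at `0`. -/
def loopCM (J : LinearMap.BilinForm ℤ Λ) :
    CrossedModule (CentralExt (loopBichar J)) (Multiplicative (PathGroup Λ)) :=
  CentralExt.crossedModule (loopBichar J) (LoopGroup Λ).subtype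
    (fun φ γ => expC (pairing (symForm J) (lift φ) (lift γ.1)))
    (fun φ ψ γ => by rw [pairing_lift_add_left, expC_add])
    (fun φ γ δ => by rw [← expC_add, ← pairing_lift_add_right]; rfl)
    (fun φ γ => by
      change expC (pairing (symForm J) (lift φ.1) (lift γ.1)) * (cocycle J φ γ)⁻¹ =
        (cocycle J γ φ)⁻¹
      rw [eq_inv_iff_mul_eq_one, mul_right_comm, mul_inv_eq_one, cocycle, cocycle, ← expC_add,
        pairing_symForm J (lift_spec φ.1).smooth (lift_spec γ.1).smooth (lift_spec φ.1).zero,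
        expC_add]
      obtain ⟨k, hk⟩ : ∃ k : ℤ, realForm J (lift γ.1 1) (lift φ.1 1) = k := by
        rw [realForm_apply (Module.Free.chooseBasis ℤ Λ)]
        choose n hn using fun χ => lift_one_integral γ χ
        choose n' hn' using fun χ => lift_one_integral φ χ
        exact ⟨∑ i, n ((Module.Free.chooseBasis ℤ Λ).coord i) *
          n' (J (Module.Free.chooseBasis ℤ Λ i)), by simp only [hn, hn']; push_cast; rfl⟩
      rw [hk, expC_int, mul_one])

/-! The three crossed modules, spelled out. -/

lemma strictCM_bd (J : LinearMap.BilinForm ℤ Λ) (z : Circle) (m : Λ) :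
    (strictCM J).bd ⟨z, m⟩ = Multiplicative.ofAdd (inclLat m) := rfl

lemma strictCM_act (J : LinearMap.BilinForm ℤ Λ) (x : LieAlg Λ) (z : Circle) (m : Λ) :
    (strictCM J).act (Multiplicative.ofAdd x) ⟨z, m⟩ =
      ⟨expC (realForm J (inclLat m) x) * z, m⟩ := rfl

lemma latticeCM_bd (J : LinearMap.BilinForm ℤ Λ) (z : Circle) (m : Λ) :
    (latticeCM J).bd ⟨z, m⟩ = Multiplicative.ofAdd (inclLat m) := rfl

lemma latticeCM_act (J : LinearMap.BilinForm ℤ Λ) (x : LieAlg Λ) (z : Circle) (m : Λ) :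
    (latticeCM J).act (Multiplicative.ofAdd x) ⟨z, m⟩ =
      ⟨expC (realForm (symForm J) x (inclLat m) / 2) * z, m⟩ := rfl

lemma loopCM_bd (J : LinearMap.BilinForm ℤ Λ) (z : Circle) (γ : LoopGroup Λ) :
    (loopCM J).bd ⟨z, γ⟩ = Multiplicative.ofAdd γ.1 := rfl

lemma loopCM_act (J : LinearMap.BilinForm ℤ Λ) (φ : PathGroup Λ) (z : Circle) (γ : LoopGroup Λ) :
    (loopCM J).act (Multiplicative.ofAdd φ) ⟨z, γ⟩ =
      ⟨expC (pairing (symForm J) (lift φ) (lift γ.1)) * z, γ⟩ := rfl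

/-! ### The straight paths -/

/-- The path `γ_x(t) = exp(t x)`. -/
def linePath (x : LieAlg Λ) : PathGroup Λ :=
  ⟨fun s => expT Λ ((s : ℝ) • x), fun χ => by
    have h : ContDiff ℝ ∞ (fun s : ℝ => Complex.exp (((2 * Real.pi * (s * ev χ x) : ℝ) : ℂ) *
        Complex.I)) :=
      ((Complex.ofRealCLM.contDiff.comp (contDiff_const.mul
        (contDiff_id.mul contDiff_const))).mul contDiff_const).cexp
    refine h.contDiffOn.congr fun s hs => ?_
    simp only [ext01, Set.IccExtend_of_mem _ _ hs, ev_expT, ev_smul]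
    change ((Circle.exp (2 * Real.pi * (s * ev χ x)) : Circle) : ℂ) = _
    rw [Circle.coe_exp], by simp⟩

/-- The loop `γ_m(t) = exp(t m)` of a lattice vector `m`. -/
def lineLoop (m : Λ) : LoopGroup Λ :=
  ⟨linePath (inclLat m), by
    change expT Λ (((1 : unitInterval) : ℝ) • inclLat m) = 0
    have h : expU 1 = 0 := expU_eq_zero.mpr ⟨1, by simp⟩
    rw [Set.Icc.coe_one, one_smul]
    change expU 1 ⊗ₜ[ℤ] m = 0
    rw [h, TensorProduct.zero_tmul]⟩

/-! ### Smooth structures -/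

/-- The standard smooth structure of `𝔱`, given by the linear coordinates. -/
instance : DiffeologicalSpace (LieAlg Λ) :=
  functionDiffeology (fun (χ : Module.Dual ℤ Λ) x => ev χ x)

/-- The smooth structure of `P₁T`: a family of paths is smooth if it is jointly smooth in the
parameter of the family and the time `s ∈ [0, 1]`. -/
instance : DiffeologicalSpace (PathGroup Λ) :=
  familyDiffeology (Set.Icc (0 : ℝ) 1)
    (fun (χ : Module.Dual ℤ Λ) γ s => ((ev χ (ext01 γ.1 s)).toMul : ℂ)) fun χ γ => γ.2.1 χ

instance : DiffeologicalSpace (LoopGroup Λ) := inducedDiffeology (fun γ => γ.1)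

instance : DiffeologicalSpace (CentralExt (trivialBichar Λ)) :=
  CentralExt.diffeology (discreteDiffeology Λ)

instance (J : LinearMap.BilinForm ℤ Λ) : DiffeologicalSpace (CentralExt (signBichar J)) :=
  CentralExt.diffeology (discreteDiffeology Λ)

instance (J : LinearMap.BilinForm ℤ Λ) : DiffeologicalSpace (CentralExt (loopBichar J)) :=
  CentralExt.diffeology inferInstance

end Torus

end CatTorus

end

namespace CatTorus

open Diffeology

section Torus

/-! ### Plots -/

section Plots

variable {n : ℕ}

/-! Everything rests on the straight paths. The lift of `γ_x` is `t ↦ t x`, so for any bilinear form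
`B` the integral attached to `γ_x, γ_y` is `∫₀¹ t B(x, y) dt = B(x, y) / 2` (`pairing_line`). On the
loops `γ_m, γ_n` the cocycle `c⁻¹` becomes `exp(-J(m, n) / 2) = (-1) ^ J(m, n)`, and the action of
`γ_x` on the label over `γ_m` becomes multiplication by `exp(I(x, m) / 2)`. These are exactly the
data of `Ξ`, which gives the map of crossed modules.

For `Ψ` the functor is the same on objects, but a label `(z, m)` at the source `x` is multiplied by
the phase `exp(J(x, m) / 2)`, and the tensor constraint is `exp(J(x, y) / 2)`. This form splits the
symmetric action `I / 2` into the one-sided action `J` of `Ψ` plus a coboundary. Composition is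
respected because moving the source from `x` to `x + m` contributes a sign `(-1) ^ J(m, n)`, which
the cocycle on loops cancels.

Both functors thus have phases `exp(r J)`, with `r = 0` and `r = 1/2`; `IsLineFunctor` treats them
together. Faithfulness follows from injectivity of `m ↦ γ_m` and invertibility of the phase. For
fullness, a loop joining `γ_x` to `γ_y` forces `exp x = exp y`, so it is `γ_m` with `m = y - x` in
`Λ`. For essential surjectivity, a path with lift `f` differs from `γ_x`, `x = f(1)`, by a loop.

The smooth versions need one analytic fact: `f(1)` depends smoothly on the path (`isPlot_lift_one`).
It turns the last factorisation into local sections of the submersion (`exists_linePath_add`).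
Smooth full faithfulness holds because a smooth family of lattice points is locally constant and the
phase is smooth. -/

lemma isPlot_prod_iff {A B : Type*} [DiffeologicalSpace A] [DiffeologicalSpace B]
    {p : EuclideanSpace ℝ (Fin n) → A × B} :
    IsPlot p ↔ IsPlot (fun u => (p u).1) ∧ IsPlot (fun u => (p u).2) := Iff.rfl

lemma isPlot_multiplicative_iff {A : Type*} [DiffeologicalSpace A]
    {p : EuclideanSpace ℝ (Fin n) → Multiplicative A} :
    IsPlot p ↔ IsPlot (fun u => (p u).toAdd) := Iff.rfl

lemma isPlot_circle_iff {p : EuclideanSpace ℝ (Fin n) → Circle} :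
    IsPlot p ↔ ContDiff ℝ ∞ (fun u => (p u : ℂ)) := ⟨fun h => h (), fun h _ => h⟩

lemma isEmbedding_circle_coe : Topology.IsEmbedding (fun z : Circle => (z : ℂ)) :=
  Topology.IsEmbedding.subtypeVal

lemma isPlot_circle_mul {p q : EuclideanSpace ℝ (Fin n) → Circle} (hp : IsPlot p)
    (hq : IsPlot q) : IsPlot (fun u => p u * q u) := by
  rw [isPlot_circle_iff] at *
  simpa using hp.mul hq

lemma coe_expC (r : ℝ) : (expC r : ℂ) = Complex.exp (((2 * Real.pi * r : ℝ) : ℂ) * Complex.I) :=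
  Circle.coe_exp _

lemma coe_toMul_expU (r : ℝ) :
    (((expU r).toMul : Circle) : ℂ) = Complex.exp (((2 * Real.pi * r : ℝ) : ℂ) * Complex.I) :=
  Circle.coe_exp _

lemma contDiff_cexp_two_pi :
    ContDiff ℝ ∞ fun r : ℝ => Complex.exp (((2 * Real.pi * r : ℝ) : ℂ) * Complex.I) :=
  ((Complex.ofRealCLM.contDiff.comp (contDiff_const.mul contDiff_id)).mul contDiff_const).cexp

lemma isPlot_expC {f : EuclideanSpace ℝ (Fin n) → ℝ} (hf : ContDiff ℝ ∞ f) :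
    IsPlot (fun u => expC (f u)) := by
  rw [isPlot_circle_iff]
  simp only [coe_expC]
  exact contDiff_cexp_two_pi.comp hf

lemma expC_zero : expC 0 = 1 := by simp [expC]

end Plots

variable {Λ : Type*} [AddCommGroup Λ]

section LieAlgPlots

variable {n : ℕ}

lemma isPlot_lieAlg_iff {p : EuclideanSpace ℝ (Fin n) → LieAlg Λ} :
    IsPlot p ↔ ∀ χ : Module.Dual ℤ Λ, ContDiff ℝ ∞ (fun u => ev χ (p u)) := Iff.rfl

lemma isPlot_lieAlg_add {p q : EuclideanSpace ℝ (Fin n) → LieAlg Λ} (hp : IsPlot p)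
    (hq : IsPlot q) : IsPlot (fun u => p u + q u) := by
  rw [isPlot_lieAlg_iff] at *
  simpa only [map_add] using fun χ => (hp χ).add (hq χ)

lemma isPlot_lieAlg_sub {p q : EuclideanSpace ℝ (Fin n) → LieAlg Λ} (hp : IsPlot p)
    (hq : IsPlot q) : IsPlot (fun u => p u - q u) := by
  rw [isPlot_lieAlg_iff] at *
  simpa only [map_sub] using fun χ => (hp χ).sub (hq χ)

lemma ev_inclLat (χ : Module.Dual ℤ Λ) (m : Λ) : ev χ (inclLat m) = χ m := by
  simp [inclLat]

lemma isPlot_inclLat {p : EuclideanSpace ℝ (Fin n) → Λ} (hp : IsLocallyConstant p) :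
    IsPlot (fun u => inclLat (p u)) := by
  rw [isPlot_lieAlg_iff]
  intro χ
  rw [contDiff_iff_contDiffAt]
  intro u
  refine (contDiffAt_const (c := ev χ (inclLat (p u)))).congr_of_eventuallyEq ?_
  filter_upwards [hp.eventually_eq u] with v hv
  rw [hv]

lemma isPlot_pathGroup_iff {p : EuclideanSpace ℝ (Fin n) → PathGroup Λ} :
    IsPlot p ↔ ∀ χ : Module.Dual ℤ Λ, ContDiffOn ℝ ∞
      (fun q : EuclideanSpace ℝ (Fin n) × ℝ => ((ev χ (ext01 (p q.1).1 q.2)).toMul : ℂ))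
      (Set.univ ×ˢ Set.Icc 0 1) := Iff.rfl

lemma isPlot_pathGroup_add {p q : EuclideanSpace ℝ (Fin n) → PathGroup Λ} (hp : IsPlot p)
    (hq : IsPlot q) : IsPlot (fun u => p u + q u) := by
  rw [isPlot_pathGroup_iff] at *
  intro χ
  refine ((hp χ).mul (hq χ)).congr fun s _ => ?_
  simp [ext01, Set.IccExtend]

lemma isPlot_pathGroup_neg {p : EuclideanSpace ℝ (Fin n) → PathGroup Λ} (hp : IsPlot p) :
    IsPlot (fun u => -p u) := by
  rw [isPlot_pathGroup_iff] at *
  intro χ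
  refine ((Complex.conjCLE.contDiff (n := ∞)).comp_contDiffOn (hp χ)).congr fun s _ => ?_
  change (((ev χ (-(ext01 (p s.1).1 s.2))).toMul : Circle) : ℂ) = (starRingEnd ℂ) _
  rw [map_neg, toMul_neg, Circle.coe_inv_eq_conj]

lemma isPlot_linePath {p : EuclideanSpace ℝ (Fin n) → LieAlg Λ} (hp : IsPlot p) :
    IsPlot (fun u => linePath (p u)) := by
  rw [isPlot_lieAlg_iff] at hp
  rw [isPlot_pathGroup_iff]
  intro χ
  refine ((contDiff_cexp_two_pi.comp
    (contDiff_snd.mul ((hp χ).comp contDiff_fst))).contDiffOn).congr fun q hq => ?_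
  change (((ev χ (ext01 (fun s : unitInterval => expT Λ ((s : ℝ) • p q.1)) q.2)).toMul : Circle) : ℂ)
    = _
  simp only [ext01, Set.IccExtend_of_mem _ _ hq.2, ev_expT, ev_smul, coe_toMul_expU]
  rfl

end LieAlgPlots

/-! ### Straight paths -/

lemma linePath_apply (x : LieAlg Λ) (s : unitInterval) :
    (linePath x) s = expT Λ ((s : ℝ) • x) := rfl

lemma linePath_add (x y : LieAlg Λ) : linePath (x + y) = linePath x + linePath y := by
  refine Subtype.ext (funext fun s => ?_)
  change expT Λ _ = expT Λ _ + expT Λ _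
  rw [smul_add, map_add]

lemma linePath_zero : linePath (0 : LieAlg Λ) = 0 := by
  simpa using linePath_add (0 : LieAlg Λ) 0

lemma linePath_neg (x : LieAlg Λ) : linePath (-x) = -linePath x := by
  rw [eq_neg_iff_add_eq_zero, ← linePath_add, neg_add_cancel, linePath_zero]

lemma linePath_sub (x y : LieAlg Λ) : linePath (x - y) = linePath x - linePath y := by
  rw [sub_eq_add_neg, sub_eq_add_neg, linePath_add, linePath_neg]

lemma linePath_one (x : LieAlg Λ) : (linePath x) 1 = expT Λ x := by
  simp [linePath_apply]

lemma lineLoop_coe (m : Λ) : (lineLoop m).1 = linePath (inclLat m) := rfl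

lemma lineLoop_add (m n : Λ) : lineLoop (m + n) = lineLoop m + lineLoop n := by
  refine Subtype.ext ?_
  change linePath (inclLat (m + n)) = linePath (inclLat m) + linePath (inclLat n)
  rw [map_add, linePath_add]

lemma lineLoop_zero : lineLoop (0 : Λ) = 0 := by
  simpa using lineLoop_add (0 : Λ) 0

lemma isSmoothInLieAlg_line (x : LieAlg Λ) :
    IsSmoothInLieAlg fun s : unitInterval => (s : ℝ) • x := fun χ => by
  refine (contDiff_id.mul (contDiff_const (c := ev χ x))).contDiffOn.congr fun s hs => ?_
  simp only [ext01, Set.IccExtend_of_mem _ _ hs, ev_smul, id]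

lemma isLift_linePath (x : LieAlg Λ) :
    IsLift (linePath x) fun s : unitInterval => (s : ℝ) • x :=
  ⟨isSmoothInLieAlg_line x, by simp, fun _ => rfl⟩

lemma pairing_line (B : LinearMap.BilinForm ℤ Λ) (x y : LieAlg Λ) :
    pairing B (fun s : unitInterval => (s : ℝ) • x) (fun s : unitInterval => (s : ℝ) • y) =
      realForm B x y / 2 := by
  have h : ∀ t ∈ Set.Ioo (0 : ℝ) 1, deriv (fun r => realForm B
      (ext01 (fun s : unitInterval => (s : ℝ) • x) t)
      (ext01 (fun s : unitInterval => (s : ℝ) • y) r)) t = t * realForm B x y := by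
    intro t ht
    have hI := Set.Ioo_subset_Icc_self ht
    have h1 : HasDerivAt (fun r : ℝ => r * (t * realForm B x y)) (t * realForm B x y) t := by
      simpa using (hasDerivAt_id t).mul_const (t * realForm B x y)
    refine (h1.congr_of_eventuallyEq ?_).deriv
    -- `ext01` is constant outside `[0, 1]`, so the linear formula holds only near interior times;
    -- the integral needs no more.
    filter_upwards [Icc_mem_nhds ht.1 ht.2] with r hr
    simp only [ext01, Set.IccExtend_of_mem _ _ hI, Set.IccExtend_of_mem _ _ hr, map_smul,
      LinearMap.smul_apply, smul_eq_mul]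
  rw [pairing, intervalIntegral.integral_congr_Ioo_of_le zero_le_one h,
    intervalIntegral.integral_mul_const, integral_id]
  ring

variable [Module.Free ℤ Λ] [Module.Finite ℤ Λ]

lemma lift_linePath (x : LieAlg Λ) :
    lift (linePath x) = fun s : unitInterval => (s : ℝ) • x :=
  (lift_spec _).unique (isLift_linePath x)

lemma pairing_lift_linePath (B : LinearMap.BilinForm ℤ Λ) (x y : LieAlg Λ) :
    pairing B (lift (linePath x)) (lift (linePath y)) = realForm B x y / 2 := by
  rw [lift_linePath, lift_linePath, pairing_line]

/-- The end point of the lift recovers `x`. -/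
lemma linePath_injective : Function.Injective (linePath (Λ := Λ)) := fun x y h => by
  have h1 := congrArg (fun γ => lift γ 1) h
  simpa [lift_linePath] using h1

omit [Module.Finite ℤ Λ] in
lemma inclLat_injective : Function.Injective (inclLat (Λ := Λ)) := fun m n h => by
  refine (Module.Free.chooseBasis ℤ Λ).ext_elem fun i => ?_
  have h1 := congrArg (ev ((Module.Free.chooseBasis ℤ Λ).coord i)) h
  simpa [ev_inclLat] using h1

lemma lineLoop_injective : Function.Injective (lineLoop (Λ := Λ)) := fun _ _ h =>
  inclLat_injective (linePath_injective (congrArg Subtype.val h))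

/-- The kernel of `exp : 𝔱 → T` is `Λ`. -/
lemma exists_inclLat_eq {x : LieAlg Λ} (hx : expT Λ x = 0) : ∃ m : Λ, inclLat m = x := by
  have h : ∀ χ : Module.Dual ℤ Λ, ∃ n : ℤ, ev χ x = n := fun χ => by
    rw [← expU_eq_zero, ← ev_expT, hx, map_zero]
  -- Every integral linear form is integral on `x`; its values on the coordinate forms of a basis
  -- are the coefficients of the lattice point.
  choose k hk using h
  let b := Module.Free.chooseBasis ℤ Λ
  refine ⟨∑ i, k (b.coord i) • b i, ?_⟩
  rw [← sum_ev b x, map_sum]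
  refine Finset.sum_congr rfl fun i _ => ?_
  rw [hk, map_zsmul]
  change k (b.coord i) • ((1 : ℝ) ⊗ₜ[ℤ] b i) = _
  rw [TensorProduct.smul_tmul', zsmul_eq_mul, mul_one]

/-- Each integral coordinate is a continuous map into the discrete set `ℤ ⊂ ℝ`, hence locally
constant, and finitely many coordinates determine a lattice point. -/
lemma isLocallyConstant_of_isPlot_inclLat {n : ℕ} {p : EuclideanSpace ℝ (Fin n) → Λ}
    (hp : IsPlot (fun u => inclLat (p u))) : IsLocallyConstant p := by
  rw [isPlot_lieAlg_iff] at hp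
  let b := Module.Free.chooseBasis ℤ Λ
  have h : ∀ i, IsLocallyConstant fun u => b.coord i (p u) := fun i => by
    rw [IsLocallyConstant.iff_continuous, Int.isClosedEmbedding_coe_real.isEmbedding.continuous_iff]
    exact (hp (b.coord i)).continuous.congr fun u => ev_inclLat _ _
  rw [IsLocallyConstant.iff_eventually_eq]
  intro u
  filter_upwards [Filter.eventually_all.mpr fun i => (h i).eventually_eq u] with v hv
  exact b.ext_elem hv

lemma contDiff_realForm {n : ℕ} (B : LinearMap.BilinForm ℤ Λ)
    {p q : EuclideanSpace ℝ (Fin n) → LieAlg Λ} (hp : IsPlot p) (hq : IsPlot q) :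
    ContDiff ℝ ∞ (fun u => realForm B (p u) (q u)) := by
  rw [isPlot_lieAlg_iff] at hp hq
  simp only [realForm_apply (Module.Free.chooseBasis ℤ Λ)]
  exact ContDiff.sum fun i _ => (hp _).mul (hq _)

/-! ### The end point of the lift depends smoothly on the path -/

lemma continuous_ev_lift (χ : Module.Dual ℤ Λ) (γ : PathGroup Λ) :
    Continuous fun s : unitInterval => ev χ (lift γ s) := by
  have := ((lift_spec γ).smooth χ).continuousOn.comp_continuous continuous_subtype_val
    (fun s : unitInterval => s.2)
  exact this.congr fun s => by simp only [Function.comp, ext01, Set.IccExtend_val]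

omit [Module.Free ℤ Λ] [Module.Finite ℤ Λ] in
lemma continuous_ev_of_isPlot {n : ℕ} {q : EuclideanSpace ℝ (Fin n) → PathGroup Λ} (hq : IsPlot q)
    (χ : Module.Dual ℤ Λ) : Continuous fun a : EuclideanSpace ℝ (Fin n) × unitInterval =>
      (ev χ ((q a.1) a.2)).toMul := by
  rw [isPlot_pathGroup_iff] at hq
  have := (hq χ).continuousOn.comp_continuous
    (f := fun a : EuclideanSpace ℝ (Fin n) × unitInterval => (a.1, (a.2 : ℝ)))
    (by fun_prop) (fun a => ⟨trivial, a.2.2⟩)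
  rw [isEmbedding_circle_coe.continuous_iff]
  exact this.congr fun a => by simp only [Function.comp, ext01, Set.IccExtend_val]

/-- While `γ / δ` stays off the negative real axis, the principal argument is a continuous logarithm
of it. It vanishes at time `0`, as does the difference of the two lifts, so by uniqueness of
continuous logarithms the two agree up to the factor `2π`. This reduces the variation of the lift's
end point to a function of the end point of the path. -/
lemma ev_lift_eq_add_arg (χ : Module.Dual ℤ Λ) (γ δ : PathGroup Λ)
    (hw : Continuous fun s : unitInterval => (ev χ (γ s)).toMul / (ev χ (δ s)).toMul)
    (h : ∀ s : unitInterval, (((ev χ (γ s)).toMul / (ev χ (δ s)).toMul : Circle) : ℂ) ∈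
      Complex.slitPlane) :
    ev χ (lift γ 1) = ev χ (lift δ 1) + (2 * Real.pi)⁻¹ *
      Complex.arg (((ev χ (γ 1)).toMul / (ev χ (δ 1)).toMul : Circle) : ℂ) := by
  let d : unitInterval → ℝ := fun s => ev χ (lift γ s) - (ev χ (lift δ s) + (2 * Real.pi)⁻¹ *
      Complex.arg (((ev χ (γ s)).toMul / (ev χ (δ s)).toMul : Circle) : ℂ))
  have hd : Continuous d := by
    refine (continuous_ev_lift χ γ).sub ((continuous_ev_lift χ δ).add
      (continuous_const.mul ?_))
    rw [continuous_iff_continuousAt]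
    intro s
    exact (Complex.continuousAt_arg (h s)).comp
      (f := fun s : unitInterval => (((ev χ (γ s)).toMul / (ev χ (δ s)).toMul : Circle) : ℂ))
      (isEmbedding_circle_coe.continuous.comp hw).continuousAt
  have hγ0 : γ 0 = 0 := γ.2.2
  have hδ0 : δ 0 = 0 := δ.2.2
  -- The defect `d` is continuous, vanishes at `0` and is killed by `expU`, so it is integer valued
  -- and therefore zero.
  have key := eq_zero_of_int_valued (h := ext01 d) hd.Icc_extend'.continuousOn
    (by simp [d, (lift_spec γ).zero, (lift_spec δ).zero, hγ0, hδ0]) (fun s _ => by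
      rw [← expU_eq_zero]
      change expU (d _) = 0
      have harg : ∀ z : Circle, expU ((2 * Real.pi)⁻¹ * Complex.arg z) = Additive.ofMul z :=
        fun z => by
          change Additive.ofMul (Circle.exp (2 * Real.pi * ((2 * Real.pi)⁻¹ * _))) = _
          rw [mul_inv_cancel_left₀ (by positivity), Circle.exp_arg]
      simp only [d, map_sub, map_add, harg, ← ev_expT, (lift_spec _).exp, ofMul_div, ofMul_toMul]
      abel) (Set.right_mem_Icc.mpr zero_le_one)
  rw [ext01, Set.IccExtend_right] at key
  exact sub_eq_zero.mp key

/-- The chosen lifts carry no a priori regularity in the parameter. Near a fixed `u`, however, the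
path `q v` is uniformly close to `q u`, so the two lifts at time `1` differ by the principal
argument of a ratio that is smooth in `v`. -/
lemma isPlot_lift_one {n : ℕ} {q : EuclideanSpace ℝ (Fin n) → PathGroup Λ} (hq : IsPlot q) :
    IsPlot (fun u => lift (q u) 1) := by
  rw [isPlot_lieAlg_iff]
  intro χ
  rw [contDiff_iff_contDiffAt]
  intro u
  have hc : Continuous fun a : EuclideanSpace ℝ (Fin n) × unitInterval =>
      (ev χ ((q a.1) a.2)).toMul / (ev χ ((q u) a.2)).toMul :=
    (continuous_ev_of_isPlot hq χ).div' ((continuous_ev_of_isPlot hq χ).comp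
      (continuous_const.prodMk continuous_snd))
  have hev : ∀ᶠ v in nhds u, ∀ s ∈ (Set.univ : Set unitInterval),
      (((ev χ ((q v) s)).toMul / (ev χ ((q u) s)).toMul : Circle) : ℂ) ∈ Complex.slitPlane := by
    -- At `v = u` the ratio is `1`, which lies in the open slit plane; compactness of `[0, 1]` gives
    -- one neighbourhood of `u` that works for all times.
    refine isCompact_univ.eventually_forall_of_forall_eventually (P := fun v s =>
      (((ev χ ((q v) s)).toMul / (ev χ ((q u) s)).toMul : Circle) : ℂ) ∈ Complex.slitPlane)
      fun s _ => ?_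
    refine (isEmbedding_circle_coe.continuous.comp hc).continuousAt.eventually
      (Complex.isOpen_slitPlane.mem_nhds ?_)
    simp [Complex.one_mem_slitPlane]
  have hsm : ContDiff ℝ ∞ fun v =>
      (((ev χ ((q v) 1)).toMul / (ev χ ((q u) 1)).toMul : Circle) : ℂ) := by
    rw [isPlot_pathGroup_iff] at hq
    have h1 : ContDiff ℝ ∞ fun v => (((ev χ ((q v) 1)).toMul : Circle) : ℂ) := by
      rw [← contDiffOn_univ]
      refine ((hq χ).comp (f := fun v => (v, (1 : ℝ)))
        (contDiff_id.prodMk contDiff_const).contDiffOn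
        (fun v _ => ⟨trivial, Set.right_mem_Icc.mpr zero_le_one⟩)).congr fun v _ => ?_
      simp only [Function.comp, ext01, Set.IccExtend_right]
      rfl
    simpa only [Circle.coe_div] using h1.div_const _
  have harg : ContDiffAt ℝ ∞ (fun v => Complex.arg
      (((ev χ ((q v) 1)).toMul / (ev χ ((q u) 1)).toMul : Circle) : ℂ)) u := by
    -- The argument is the imaginary part of the logarithm, which is smooth on the slit plane.
    simp only [← Complex.log_im]
    have hlog := ((Complex.contDiffAt_log (n := ∞) (hev.self_of_nhds 1 trivial)).restrict_scalars ℝ)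
    exact Complex.imCLM.contDiff.contDiffAt.comp u (hlog.comp u hsm.contDiffAt)
  refine ((contDiffAt_const (c := ev χ (lift (q u) 1))).add
    ((contDiffAt_const (c := (2 * Real.pi)⁻¹)).mul harg)).congr_of_eventuallyEq ?_
  filter_upwards [hev] with v hv
  exact ev_lift_eq_add_arg χ (q v) (q u) (hc.comp (continuous_const.prodMk continuous_id))
    fun s => hv s trivial

end Torus

end CatTorus

namespace CatTorus

open Diffeology CategoryTheory MonoidalCategory

noncomputable section Torus

variable {Λ : Type*} [AddCommGroup Λ]

variable [Module.Free ℤ Λ] [Module.Finite ℤ Λ]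

/-! ### Plots of the central extensions -/

lemma isPlot_loopExt_iff {J : LinearMap.BilinForm ℤ Λ} {n : ℕ}
    {p : EuclideanSpace ℝ (Fin n) → CentralExt (loopBichar J)} :
    IsPlot p ↔ IsPlot (fun u => (p u).z) ∧ IsPlot (fun u => (p u).base.1) := Iff.rfl

lemma loopCM_bd_apply (J : LinearMap.BilinForm ℤ Λ) (h : CentralExt (loopBichar J)) :
    (loopCM J).bd h = Multiplicative.ofAdd h.base.1 := rfl

/-- The smooth structure `U(1) × Λ` on a central extension of `Λ`. -/
abbrev latticeExtDiffeology {c : Bichar Λ} : DiffeologicalSpace (CentralExt c) :=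
  CentralExt.diffeology (discreteDiffeology Λ)

omit [Module.Free ℤ Λ] [Module.Finite ℤ Λ] in
attribute [local instance] latticeExtDiffeology in
lemma isPlot_latticeExt_iff {c : Bichar Λ} {n : ℕ}
    {p : EuclideanSpace ℝ (Fin n) → CentralExt c} :
    IsPlot p ↔ IsPlot (fun u => (p u).z) ∧ IsLocallyConstant (fun u => (p u).base) := Iff.rfl

/-! ### Functors given by straight paths are equivalences of categorical Lie groups -/

section Line

variable {J : LinearMap.BilinForm ℤ Λ} {c : Bichar Λ}
  {X : CrossedModule (CentralExt c) (Multiplicative (LieAlg Λ))}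

/-- A monoidal functor to the categorical group of the loop group crossed module is given by
straight paths, with constraint of the form `exp(r J(x, y))`. -/
structure IsLineFunctor (r : ℝ) (F : TwoGroup X ⥤ TwoGroup (loopCM J)) [F.Monoidal] : Prop where
  bd : ∀ h, X.bd h = Multiplicative.ofAdd (inclLat h.base)
  obj : ∀ x : TwoGroup X, (F.obj x).val = Multiplicative.ofAdd (linePath x.val.toAdd)
  map : ∀ {x y : TwoGroup X} (f : x ⟶ y), TwoGroup.label (F.map f) =
    ⟨(TwoGroup.label f).z *
      expC (r * realForm J x.val.toAdd (inclLat (TwoGroup.label f).base)),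
      lineLoop (TwoGroup.label f).base⟩
  tensor : ∀ x y : TwoGroup X, TwoGroup.label (Functor.LaxMonoidal.μ F x y) =
    ⟨expC (r * realForm J x.val.toAdd y.val.toAdd), 0⟩

omit J in
-- This provides the local sections for smooth essential surjectivity: a factorisation of one path
-- of a smooth family as a straight path times a loop extends to the whole family, with the
-- prescribed factors at `u`.
lemma exists_linePath_add {n : ℕ} {q : EuclideanSpace ℝ (Fin n) → PathGroup Λ} (hq : IsPlot q)
    {u : EuclideanSpace ℝ (Fin n)} {x₀ : LieAlg Λ} {γ₀ : LoopGroup Λ}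
    (h₀ : linePath x₀ + γ₀.1 = q u) :
    ∃ (x : EuclideanSpace ℝ (Fin n) → LieAlg Λ) (γ : EuclideanSpace ℝ (Fin n) → LoopGroup Λ),
      IsPlot x ∧ IsPlot (fun v => (γ v).1) ∧ x u = x₀ ∧ γ u = γ₀ ∧
      ∀ v, linePath (x v) + (γ v).1 = q v := by
  have hau : expT Λ x₀ = (q u).1 1 := by
    have h1 : γ₀.1.1 1 = 0 := γ₀.2
    have h2 : (linePath x₀).1 1 + γ₀.1.1 1 = (q u).1 1 := by rw [← h₀]; rfl
    rwa [h1, add_zero, linePath_one] at h2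
  -- The end point of the lift works up to the kernel of `exp`. The constant shift makes `x u = x₀`,
  -- and it lies in that kernel because `x₀` and `lift (q u) 1` both map to the end point of `q u`.
  obtain ⟨x, hx⟩ : ∃ x : EuclideanSpace ℝ (Fin n) → LieAlg Λ,
    ∀ v, x v = lift (q v) 1 + (x₀ - lift (q u) 1) := ⟨_, fun _ => rfl⟩
  have hxp : IsPlot x := by
    rw [funext hx]
    exact isPlot_lieAlg_add (isPlot_lift_one hq) isPlot_const
  have hloop : ∀ v, q v + -linePath (x v) ∈ LoopGroup Λ := fun v => by
    change (q v).1 1 + -(linePath (x v)).1 1 = 0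
    rw [linePath_one, hx, map_add, map_sub, (lift_spec _).exp, (lift_spec _).exp, hau, sub_self,
      add_zero, add_neg_cancel]
  have hxu : x u = x₀ := by rw [hx, add_sub_cancel]
  refine ⟨x, fun v => ⟨_, hloop v⟩, hxp,
    isPlot_pathGroup_add hq (isPlot_pathGroup_neg (isPlot_linePath hxp)), hxu,
    Subtype.ext ?_, fun v => ?_⟩
  · change q u + -linePath (x u) = γ₀.1
    rw [hxu, ← h₀, add_neg_cancel_comm]
  · rw [add_comm, neg_add_cancel_right]

namespace IsLineFunctor

variable {r : ℝ} {F : TwoGroup X ⥤ TwoGroup (loopCM J)} [F.Monoidal]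

lemma faithful (hF : IsLineFunctor r F) : F.Faithful where
  map_injective {x y f g} h := by
    have h1 := congrArg TwoGroup.label h
    rw [hF.map, hF.map] at h1
    have hb := lineLoop_injective (congrArg CentralExt.base h1)
    have hz := congrArg CentralExt.z h1
    simp only [hb] at hz
    exact TwoGroup.hom_ext (CentralExt.ext (mul_right_cancel hz) hb)

/-- At time `1` the loop contributes nothing, so `exp x = exp y` and `y - x` lies in the kernel `Λ`.
-/
lemma exists_lineLoop_eq {x y : LieAlg Λ} {γ : LoopGroup Λ}
    (h : linePath x + γ.1 = linePath y) : ∃ m : Λ, x + inclLat m = y ∧ lineLoop m = γ := by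
  have hγ : γ.1.1 1 = 0 := γ.2
  have h1 : expT Λ x + γ.1.1 1 = expT Λ y := by
    rw [← linePath_one, ← linePath_one, ← h]
    rfl
  rw [hγ, add_zero] at h1
  obtain ⟨m, hm⟩ := exists_inclLat_eq (x := y - x) (by rw [map_sub, h1, sub_self])
  refine ⟨m, by rw [hm, add_sub_cancel], Subtype.ext ?_⟩
  rw [lineLoop_coe, hm, linePath_sub, ← h, add_sub_cancel_left]

lemma full (hF : IsLineFunctor r F) : F.Full where
  map_surjective {x y} g := by
    have h := TwoGroup.label_target g
    rw [hF.obj, hF.obj, loopCM_bd_apply] at h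
    obtain ⟨m, hm, hγ⟩ := exists_lineLoop_eq (γ := (TwoGroup.label g).base) h
    -- The preimage label is corrected by the inverse of the phase that the functor introduces.
    refine ⟨⟨⟨(TwoGroup.label g).z * (expC (r * realForm J x.val.toAdd (inclLat m)))⁻¹, m⟩, ?_⟩,
      TwoGroup.hom_ext ?_⟩
    · rw [hF.bd]
      exact hm
    · rw [hF.map]
      exact CentralExt.ext (inv_mul_cancel_right _ _) hγ

lemma essSurj (hF : IsLineFunctor r F) : F.EssSurj where
  mem_essImage y := by
    let γ : PathGroup Λ := y.val.toAdd
    -- The straight path to the end point of the lift ends where `γ` does, so their quotient is a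
    -- loop and labels an isomorphism.
    let x : LieAlg Λ := lift γ 1
    have hloop : γ - linePath x ∈ LoopGroup Λ := by
      change γ.1 1 - (linePath x).1 1 = 0
      rw [linePath_one, (lift_spec γ).exp, sub_self]
    have ht : (F.obj ⟨Multiplicative.ofAdd x⟩).val *
        (loopCM J).bd ⟨1, ⟨γ - linePath x, hloop⟩⟩ = y.val := by
      rw [hF.obj]
      exact congrArg Multiplicative.ofAdd (add_sub_cancel (linePath x) γ)
    refine ⟨⟨Multiplicative.ofAdd x⟩, ⟨⟨⟨⟨1, ⟨γ - linePath x, hloop⟩⟩, ht⟩,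
      ⟨(⟨1, ⟨γ - linePath x, hloop⟩⟩ : CentralExt (loopBichar J))⁻¹, ?_⟩, ?_, ?_⟩⟩⟩
    · rw [← ht, map_inv, mul_inv_cancel_right]
    · exact TwoGroup.hom_ext (mul_inv_cancel _)
    · exact TwoGroup.hom_ext (inv_mul_cancel _)

lemma isEquivalence (hF : IsLineFunctor r F) : F.IsEquivalence where
  faithful := hF.faithful
  full := hF.full
  essSurj := hF.essSurj

lemma isPlot_phase {n : ℕ} {p q : EuclideanSpace ℝ (Fin n) → LieAlg Λ} (r : ℝ)
    (hp : IsPlot p) (hq : IsPlot q) : IsPlot fun u => expC (r * realForm J (p u) (q u)) :=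
  isPlot_expC (contDiff_const.mul (contDiff_realForm J hp hq))

lemma smooth_obj (hF : IsLineFunctor r F) :
    DSmooth (fun x : Multiplicative (LieAlg Λ) => (F.obj ⟨x⟩).val) := by
  intro n p hp
  simp only [Function.comp_def, hF.obj]
  exact isPlot_linePath hp

lemma submersion (hF : IsLineFunctor r F) :
    IsSubmersion (fun a : Multiplicative (LieAlg Λ) × CentralExt (loopBichar J) =>
      (F.obj ⟨a.1⟩).val * (loopCM J).bd a.2) := by
  simp only [hF.obj]
  refine ⟨fun n p hp => ?_, fun n q hq u a ha => ?_⟩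
  · rw [isPlot_prod_iff, isPlot_loopExt_iff] at hp
    exact isPlot_pathGroup_add (isPlot_linePath hp.1) hp.2.2
  · obtain ⟨x, γ, hx, hγ, hxu, hγu, h⟩ :=
      exists_linePath_add (x₀ := a.1.toAdd) (γ₀ := a.2.base) (isPlot_multiplicative_iff.mp hq) ha
    -- The boundary map forgets the circle component, which can be kept constant.
    refine ⟨fun v => (Multiplicative.ofAdd (x v), ⟨a.2.z, γ v⟩), ?_, ?_,
      Filter.Eventually.of_forall fun v => congrArg Multiplicative.ofAdd (h v)⟩
    · rw [isPlot_prod_iff, isPlot_loopExt_iff]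
      exact ⟨hx, isPlot_const, hγ⟩
    · simp only [hxu, hγu]
      rfl

lemma smooth_tensor (hF : IsLineFunctor r F) :
    DSmooth (fun a : Multiplicative (LieAlg Λ) × Multiplicative (LieAlg Λ) =>
      TwoGroup.label (Functor.LaxMonoidal.μ F (⟨a.1⟩ : TwoGroup X) ⟨a.2⟩)) := by
  simp only [hF.tensor]
  intro n p hp
  rw [isPlot_prod_iff] at hp
  exact isPlot_loopExt_iff.mpr ⟨isPlot_phase r hp.1 hp.2, isPlot_const⟩

section Diffeology

attribute [local instance] latticeExtDiffeology

lemma smooth_map (hF : IsLineFunctor r F) :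
    DSmooth (fun a : Multiplicative (LieAlg Λ) × CentralExt c =>
      TwoGroup.label (F.map (TwoGroup.arrow X a.1 a.2))) := by
  simp only [hF.map]
  intro n p hp
  rw [isPlot_prod_iff, isPlot_latticeExt_iff] at hp
  have hm := isPlot_inclLat hp.2.2
  exact isPlot_loopExt_iff.mpr
    ⟨isPlot_circle_mul hp.2.1 (isPlot_phase r hp.1 hm), isPlot_linePath hm⟩

lemma cartesian (hF : IsLineFunctor r F) {n : ℕ}
    {p : EuclideanSpace ℝ (Fin n) → Multiplicative (LieAlg Λ) × CentralExt c}
    (hx : IsPlot fun u => (p u).1) (hy : IsPlot fun u => (p u).1 * X.bd (p u).2)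
    (hl : IsPlot fun u => TwoGroup.label (F.map (TwoGroup.arrow X (p u).1 (p u).2))) :
    IsPlot p := by
  simp only [hF.bd] at hy
  simp only [hF.map] at hl
  rw [isPlot_loopExt_iff] at hl
  rw [isPlot_multiplicative_iff] at hx hy
  -- The lattice component is the difference of target and source, so it is smooth as a map to `𝔱`.
  have hm : IsPlot fun u => inclLat (p u).2.base := by
    have h := isPlot_lieAlg_sub hy hx
    simpa only [toAdd_mul, toAdd_ofAdd, add_sub_cancel_left] using h
  have hz : IsPlot fun u => (p u).2.z := by
    -- The phase with `-r` undoes the phase with `r` and is smooth because `x` and `m` are.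
    have h := isPlot_circle_mul hl.1 (isPlot_phase (J := J) (-r) hx hm)
    have e : ∀ a : ℝ, expC (r * a) * expC (-r * a) = 1 := fun a => by
      rw [← expC_add, neg_mul, add_neg_cancel, expC_zero]
    refine (congrArg IsPlot (funext fun u => ?_)).mpr h
    exact (mul_one (p u).2.z).symm.trans
      ((congrArg ((p u).2.z * ·) (e _).symm).trans (mul_assoc _ _ _).symm)
  rw [isPlot_prod_iff, isPlot_latticeExt_iff]
  exact ⟨hx, hz, isLocallyConstant_of_isPlot_inclLat hm⟩

end Diffeology

/-- The equation `hd` allows the two extensions `signBichar J` and `trivialBichar Λ`, each with its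
own diffeology instance, to share the argument. -/
lemma isLieEquivalence [d : DiffeologicalSpace (CentralExt c)]
    (hd : d = latticeExtDiffeology) (hF : IsLineFunctor r F) :
    IsLieEquivalence F where
  isEquivalence := hF.isEquivalence
  smooth_obj := hF.smooth_obj
  submersion := hF.submersion
  smooth_map := by
    subst hd
    exact hF.smooth_map
  smooth_tensor := hF.smooth_tensor
  cartesian n p hx hy hl := by
    subst hd
    exact hF.cartesian hx hy hl

end IsLineFunctor

end Line

/-! ### The inclusion of the lattice crossed module -/

variable (J : LinearMap.BilinForm ℤ Λ)

/-- The factor `1/2` in the pairing of straight paths turns `exp` into a sign, and a sign is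
unaffected by the inverse in `c⁻¹`. -/
lemma loopBichar_lineLoop (m n : Λ) :
    (loopBichar J).toFun (lineLoop m) (lineLoop n) = (-1) ^ (J m n) := by
  change (expC (pairing J (lift (linePath (inclLat m))) (lift (linePath (inclLat n)))))⁻¹ = _
  rw [pairing_lift_linePath, realForm_inclLat, expC_half_int, ← inv_zpow, inv_neg, inv_one]

/-- The map of crossed modules `x ↦ γ_x`, `(z, m) ↦ (z, γ_m)`. -/
def lineHom : CrossedModule.Hom (latticeCM J) (loopCM J) where
  base :=
    { toFun := fun x => Multiplicative.ofAdd (linePath x.toAdd)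
      map_one' := congrArg Multiplicative.ofAdd linePath_zero
      map_mul' := fun x y => congrArg Multiplicative.ofAdd (linePath_add x.toAdd y.toAdd) }
  top :=
    { toFun := fun h => ⟨h.z, lineLoop h.base⟩
      map_one' := CentralExt.ext rfl lineLoop_zero
      map_mul' := fun h k => by
        refine CentralExt.ext ?_ (lineLoop_add h.base k.base)
        rw [CentralExt.mul_z, CentralExt.mul_z, loopBichar_lineLoop]
        rfl }
  bd_top _ := rfl
  top_act x h := by
    refine CentralExt.ext ?_ rfl
    change expC (realForm (symForm J) x.toAdd (inclLat h.base) / 2) * h.z =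
      expC (pairing (symForm J) (lift (linePath x.toAdd)) (lift (linePath (inclLat h.base)))) * h.z
    rw [pairing_lift_linePath]

lemma isLineFunctor_lineHom : IsLineFunctor 0 (lineHom J).functor where
  bd _ := rfl
  obj _ := rfl
  map f := by
    rw [zero_mul, expC_zero, mul_one]
    rfl
  tensor x y := by
    rw [zero_mul, expC_zero]
    rfl

/-- With `mul_expC_eq`, this reduces the naturality squares of the tensor constraint to linear
identities between real exponents. -/
lemma expC_mul_eq (z : Circle) {a b c d e f : ℝ} (h : a + b + c = d + e + f) :
    expC a * (z * expC b) * expC c = expC d * (z * expC e * expC f) := by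
  rw [mul_left_comm, mul_assoc, mul_assoc z, mul_left_comm _ z]
  simp only [← expC_add, ← add_assoc, h]

lemma mul_expC_eq (z : Circle) {a b c d : ℝ} (h : a + b = c + d) :
    z * expC a * expC b = expC c * (z * expC d) := by
  rw [mul_left_comm, mul_assoc, ← expC_add, ← expC_add, h]

/-! ### The comparison of the strict and the loop group crossed modules -/

omit [Module.Free ℤ Λ] [Module.Finite ℤ Λ] in
lemma realForm_symForm (x y : LieAlg Λ) :
    realForm (symForm J) x y = realForm J x y + realForm J y x := by
  induction x using TensorProduct.induction_on with
  | zero => simp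
  | tmul a m =>
    induction y using TensorProduct.induction_on with
    | zero => simp
    | tmul c n =>
      simp only [realForm, symForm, LinearMap.BilinForm.baseChange_tmul, LinearMap.add_apply,
        LinearMap.BilinForm.flip_apply, zsmul_eq_mul, Int.cast_add]
      ring
    | add y z hy hz =>
      simp only [map_add, LinearMap.add_apply, hy, hz]
      ring
  | add x z hx hz =>
    simp only [map_add, LinearMap.add_apply, hx, hz]
    ring

omit [Module.Free ℤ Λ] [Module.Finite ℤ Λ] in
lemma label_target_toAdd {x y : TwoGroup (strictCM J)} (f : x ⟶ y) :
    x.val.toAdd + inclLat (TwoGroup.label f).base = y.val.toAdd := TwoGroup.label_target f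

/-- The functor `x ↦ γ_x`, `(x, (z, m)) ↦ (z exp(J(x, m) / 2), γ_m)`. -/
def strictFunctor : TwoGroup (strictCM J) ⥤ TwoGroup (loopCM J) where
  obj x := ⟨Multiplicative.ofAdd (linePath x.val.toAdd)⟩
  map {x y} f := ⟨⟨(TwoGroup.label f).z *
    expC (1 / 2 * realForm J x.val.toAdd (inclLat (TwoGroup.label f).base)),
    lineLoop (TwoGroup.label f).base⟩, by
      change linePath x.val.toAdd + linePath (inclLat (TwoGroup.label f).base) =
        linePath y.val.toAdd
      rw [← linePath_add, label_target_toAdd]⟩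
  map_id x := by
    refine TwoGroup.hom_ext (CentralExt.ext ?_ lineLoop_zero)
    change 1 * expC (1 / 2 * realForm J x.val.toAdd (inclLat 0)) = 1
    rw [map_zero, map_zero, mul_zero, expC_zero, one_mul]
  map_comp {x y w} f g := by
    refine TwoGroup.hom_ext (CentralExt.ext ?_ (lineLoop_add _ _))
    change (TwoGroup.label f).z * (TwoGroup.label g).z * 1 * expC (1 / 2 * realForm J x.val.toAdd
        (inclLat ((TwoGroup.label f).base + (TwoGroup.label g).base))) =
      ((TwoGroup.label f).z * expC (1 / 2 * realForm J x.val.toAdd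
        (inclLat (TwoGroup.label f).base))) * ((TwoGroup.label g).z *
        expC (1 / 2 * realForm J y.val.toAdd (inclLat (TwoGroup.label g).base))) *
      (loopBichar J).toFun (lineLoop (TwoGroup.label f).base) (lineLoop (TwoGroup.label g).base)
    rw [loopBichar_lineLoop, ← label_target_toAdd J f, map_add, map_add, map_add,
      LinearMap.add_apply, realForm_inclLat, mul_add, mul_add, expC_add, expC_add,
      one_div_mul_eq_div 2 ((J _ _ : ℤ) : ℝ), expC_half_int]
    generalize (J (TwoGroup.label f).base) (TwoGroup.label g).base = k
    -- The sign `(-1) ^ J(m, n)` occurs twice on the right: from the shifted source `x + m` of the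
    -- second arrow, and from the cocycle on loops. The two occurrences cancel, matching the trivial
    -- cocycle of `Ψ`.
    have hk : ((-1 : Circle) ^ k) * (-1 : Circle) ^ k = 1 := by
      rw [← mul_zpow]
      simp
    generalize (-1 : Circle) ^ k = e at hk ⊢
    generalize (TwoGroup.label f).z = z, (TwoGroup.label g).z = w
    generalize expC _ = b, expC _ = a
    calc z * w * 1 * (a * b) = z * w * (a * b) * (e * e) := by rw [hk, mul_one, mul_one]
      _ = z * a * (w * (b * e)) * e := by simp only [mul_comm, mul_left_comm]

/-! ### The monoidal structure of the comparison functor -/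

/-- The automorphism of an object with label `(z, 0)`. -/
def centralIso (z : Circle) {x y : TwoGroup (loopCM J)} (h : x.val = y.val) : x ≅ y where
  hom := ⟨⟨z, 0⟩, by
    rw [loopCM_bd_apply, ← h]
    exact mul_one x.val⟩
  inv := ⟨⟨z⁻¹, 0⟩, by
    rw [loopCM_bd_apply, ← h]
    exact mul_one x.val⟩
  hom_inv_id := TwoGroup.hom_ext (CentralExt.ext (by
    change z * z⁻¹ * (loopBichar J).toFun 0 0 = 1
    rw [CentralExt.zero_left, mul_inv_cancel, one_mul]) (add_zero 0))
  inv_hom_id := TwoGroup.hom_ext (CentralExt.ext (by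
    change z⁻¹ * z * (loopBichar J).toFun 0 0 = 1
    rw [CentralExt.zero_left, inv_mul_cancel, one_mul]) (add_zero 0))

lemma loopCM_act_central (φ : Multiplicative (PathGroup Λ)) (z : Circle) :
    (loopCM J).act φ ⟨z, 0⟩ = ⟨z, 0⟩ := by
  refine CentralExt.ext ?_ rfl
  -- Additivity at `0 + 0` shows that the pairing with the trivial loop is zero.
  have h := pairing_lift_add_right (symForm J) φ.toAdd 0 0
  rw [add_zero, left_eq_add] at h
  change expC (pairing (symForm J) (lift φ.toAdd) (lift 0)) * z = z
  rw [h, expC_zero, one_mul]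

lemma loopExt_central_mul (z : Circle) (h : CentralExt (loopBichar J)) :
    (⟨z, 0⟩ : CentralExt (loopBichar J)) * h = ⟨z * h.z, h.base⟩ := by
  refine CentralExt.ext ?_ (zero_add _)
  rw [CentralExt.mul_z, CentralExt.zero_left, mul_one]

lemma loopExt_mul_central (z : Circle) (h : CentralExt (loopBichar J)) :
    h * (⟨z, 0⟩ : CentralExt (loopBichar J)) = ⟨h.z * z, h.base⟩ := by
  refine CentralExt.ext ?_ (add_zero _)
  rw [CentralExt.mul_z, CentralExt.zero_right, mul_one]

lemma label_strictFunctor_map {x y : TwoGroup (strictCM J)} (f : x ⟶ y) :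
    TwoGroup.label ((strictFunctor J).map f) = ⟨(TwoGroup.label f).z *
      expC (1 / 2 * realForm J x.val.toAdd (inclLat (TwoGroup.label f).base)),
      lineLoop (TwoGroup.label f).base⟩ := rfl

lemma strictFunctor_obj_val (x : TwoGroup (strictCM J)) :
    ((strictFunctor J).obj x).val = Multiplicative.ofAdd (linePath x.val.toAdd) := rfl

/-- The tensor constraint of `strictFunctor`, with label `(exp(J(x, y) / 2), 0)`. -/
def strictMuIso (x y : TwoGroup (strictCM J)) :
    (strictFunctor J).obj x ⊗ (strictFunctor J).obj y ≅ (strictFunctor J).obj (x ⊗ y) :=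
  centralIso J (expC (1 / 2 * realForm J x.val.toAdd y.val.toAdd))
    (congrArg Multiplicative.ofAdd (linePath_add x.val.toAdd y.val.toAdd).symm)

lemma label_strictMuIso (x y : TwoGroup (strictCM J)) :
    TwoGroup.label (strictMuIso J x y).hom =
      ⟨expC (1 / 2 * realForm J x.val.toAdd y.val.toAdd), 0⟩ := rfl

omit [Module.Free ℤ Λ] [Module.Finite ℤ Λ] in
lemma strictCM_act_apply (x : Multiplicative (LieAlg Λ)) (h : CentralExt (trivialBichar Λ)) :
    (strictCM J).act x h = ⟨expC (realForm J (inclLat h.base) x.toAdd) * h.z, h.base⟩ := rfl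

lemma loopCM_act_linePath (y : LieAlg Λ) (z : Circle) (m : Λ) :
    (loopCM J).act (Multiplicative.ofAdd (linePath y)) ⟨z, lineLoop m⟩ =
      ⟨expC (1 / 2 * (realForm J y (inclLat m) + realForm J (inclLat m) y)) * z, lineLoop m⟩ := by
  rw [loopCM_act, lineLoop_coe, pairing_lift_linePath, realForm_symForm, one_div_mul_eq_div]

/-- Meant for associators and unitors: their lattice component is `0`, so they acquire no phase. -/
lemma strictFunctor_map_of_label_eq_one {x y : TwoGroup (strictCM J)} {f : x ⟶ y}
    (hf : TwoGroup.label f = 1) : TwoGroup.label ((strictFunctor J).map f) = 1 := by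
  rw [label_strictFunctor_map, hf]
  refine CentralExt.ext ?_ lineLoop_zero
  change 1 * expC (1 / 2 * realForm J x.val.toAdd (inclLat 0)) = 1
  rw [map_zero, map_zero, mul_zero, expC_zero, one_mul]

/-- The only coherence condition that involves both actions. With `m` the lattice part of `f`, both
sides multiply its circle part by the phase with exponent `(J(x, y) + J(x, m) + J(y, m)) / 2 + J(m,
y)`. On the left one half of `J(m, y)` comes from the action `I / 2` and the other from the
constraint at `x + m`; on the right all of it is the action of `Ψ`. -/
lemma strictMuIso_natural_left {x x' : TwoGroup (strictCM J)} (f : x ⟶ x')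
    (y : TwoGroup (strictCM J)) :
    (strictFunctor J).map f ▷ (strictFunctor J).obj y ≫ (strictMuIso J x' y).hom =
      (strictMuIso J x y).hom ≫ (strictFunctor J).map (f ▷ y) := by
  ext1
  simp only [TwoGroup.label_comp, TwoGroup.label_whiskerRight, label_strictFunctor_map,
    label_strictMuIso, strictFunctor_obj_val, loopCM_act_linePath, strictCM_act_apply,
    loopExt_mul_central, loopExt_central_mul, TwoGroup.tensorObj_val, toAdd_mul,
    ← label_target_toAdd J f, map_add, LinearMap.add_apply]
  refine congrArg (CentralExt.mk · _) ?_
  rw [mul_comm (expC (realForm J _ _)) (TwoGroup.label f).z]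
  refine expC_mul_eq _ ?_
  ring

lemma strictMuIso_natural_right {y y' : TwoGroup (strictCM J)} (x : TwoGroup (strictCM J))
    (f : y ⟶ y') :
    (strictFunctor J).obj x ◁ (strictFunctor J).map f ≫ (strictMuIso J x y').hom =
      (strictMuIso J x y).hom ≫ (strictFunctor J).map (x ◁ f) := by
  ext1
  simp only [TwoGroup.label_comp, TwoGroup.label_whiskerLeft, label_strictFunctor_map,
    label_strictMuIso, loopExt_mul_central, loopExt_central_mul, TwoGroup.tensorObj_val,
    toAdd_mul, ← label_target_toAdd J f, map_add, LinearMap.add_apply]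
  refine congrArg (CentralExt.mk · _) ?_
  refine mul_expC_eq _ ?_
  ring

/-- The constraint is bimultiplicative in the objects, hence a 2-cocycle, and its central labels are
fixed by the action. -/
lemma strictMuIso_associativity (x y w : TwoGroup (strictCM J)) :
    (strictMuIso J x y).hom ▷ (strictFunctor J).obj w ≫ (strictMuIso J (x ⊗ y) w).hom ≫
        (strictFunctor J).map (α_ x y w).hom =
      (α_ _ _ _).hom ≫ (strictFunctor J).obj x ◁ (strictMuIso J y w).hom ≫
        (strictMuIso J x (y ⊗ w)).hom := by
  have h1 : TwoGroup.label ((strictFunctor J).map (α_ x y w).hom) = 1 :=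
    strictFunctor_map_of_label_eq_one J (TwoGroup.label_associator_hom x y w)
  ext1
  simp only [TwoGroup.label_comp, TwoGroup.label_whiskerLeft, TwoGroup.label_whiskerRight,
    label_strictMuIso, loopCM_act_central, TwoGroup.tensorObj_val, h1,
    TwoGroup.label_associator_hom, mul_one, one_mul, loopExt_central_mul,
    toAdd_mul, map_add, LinearMap.add_apply]
  refine congrArg (CentralExt.mk · _) ?_
  rw [← expC_add, ← expC_add]
  congr 1
  ring

/-- The unit constraint of `strictFunctor`, with label `1`. -/
def strictEpsIso : 𝟙_ (TwoGroup (loopCM J)) ≅ (strictFunctor J).obj (𝟙_ (TwoGroup (strictCM J))) :=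
  centralIso J 1 (congrArg Multiplicative.ofAdd linePath_zero.symm)

lemma label_strictEpsIso : TwoGroup.label (strictEpsIso J).hom = 1 := rfl

lemma label_strictMuIso_unit_left (x : TwoGroup (strictCM J)) :
    TwoGroup.label (strictMuIso J (𝟙_ _) x).hom = 1 := by
  refine CentralExt.ext ?_ rfl
  change expC (1 / 2 * realForm J 0 x.val.toAdd) = 1
  rw [map_zero, LinearMap.zero_apply, mul_zero, expC_zero]

lemma label_strictMuIso_unit_right (x : TwoGroup (strictCM J)) :
    TwoGroup.label (strictMuIso J x (𝟙_ _)).hom = 1 := by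
  refine CentralExt.ext ?_ rfl
  change expC (1 / 2 * realForm J x.val.toAdd 0) = 1
  rw [map_zero, mul_zero, expC_zero]

instance : (strictFunctor J).Monoidal :=
  Functor.CoreMonoidal.toMonoidal
    { εIso := strictEpsIso J
      μIso := strictMuIso J
      μIso_hom_natural_left := strictMuIso_natural_left J
      μIso_hom_natural_right := strictMuIso_natural_right J
      associativity := strictMuIso_associativity J
      left_unitality := fun x => by
        ext1
        simp only [TwoGroup.label_comp, TwoGroup.label_whiskerRight, label_strictEpsIso,
          label_strictMuIso_unit_left, map_one, mul_one, TwoGroup.label_leftUnitor_hom,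
          strictFunctor_map_of_label_eq_one J (TwoGroup.label_leftUnitor_hom x)]
      right_unitality := fun x => by
        ext1
        simp only [TwoGroup.label_comp, TwoGroup.label_whiskerLeft, label_strictEpsIso,
          label_strictMuIso_unit_right, mul_one, TwoGroup.label_rightUnitor_hom,
          strictFunctor_map_of_label_eq_one J (TwoGroup.label_rightUnitor_hom x)] }

lemma isLineFunctor_strictFunctor : IsLineFunctor (1 / 2) (strictFunctor J) where
  bd _ := rfl
  obj _ := rfl
  map _ := rfl
  tensor _ _ := rfl

lemma lineHom_top_injective : Function.Injective (lineHom J).top := fun h k e => by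
  obtain ⟨hz, hb⟩ := CentralExt.ext_iff.mp e
  exact CentralExt.ext hz (lineLoop_injective hb)

end Torus

end CatTorus

theorem mainTheorem9 {Λ : Type*} [AddCommGroup Λ] [Module.Free ℤ Λ] [Module.Finite ℤ Λ]
    (J : LinearMap.BilinForm ℤ Λ) :
    -- the straight paths make `Ξ` an equivalent sub-crossed module of `Π`
    (∃ f : CatTorus.CrossedModule.Hom (CatTorus.latticeCM J) (CatTorus.loopCM J),
      (∀ x : CatTorus.LieAlg Λ,
        f.base (Multiplicative.ofAdd x) = Multiplicative.ofAdd (CatTorus.linePath x)) ∧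
      (∀ (z : Circle) (m : Λ), f.top ⟨z, m⟩ = ⟨z, CatTorus.lineLoop m⟩) ∧
      Function.Injective f.base ∧ Function.Injective f.top ∧
      CatTorus.IsLieEquivalence f.functor) ∧
    -- the categorical tori of `Ψ` and of `Π` are equivalent extensions of `T` by `pt // U(1)`
    (∃ (F : CategoryTheory.Functor (CatTorus.TwoGroup (CatTorus.strictCM J))
          (CatTorus.TwoGroup (CatTorus.loopCM J))) (_ : F.Monoidal),
      (∀ x : CatTorus.LieAlg Λ,
        F.obj ⟨Multiplicative.ofAdd x⟩ = ⟨Multiplicative.ofAdd (CatTorus.linePath x)⟩) ∧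
      (∀ (x : CatTorus.LieAlg Λ) (z : Circle),
        CatTorus.TwoGroup.label (F.map (CatTorus.TwoGroup.arrow (CatTorus.strictCM J)
          (Multiplicative.ofAdd x) ⟨z, 0⟩)) = ⟨z, 0⟩) ∧
      CatTorus.IsLieEquivalence F) := by
  refine ⟨⟨CatTorus.lineHom J, fun _ => rfl, fun _ _ => rfl,
    fun _ _ h => CatTorus.linePath_injective h, CatTorus.lineHom_top_injective J,
    (CatTorus.isLineFunctor_lineHom J).isLieEquivalence rfl⟩,
    CatTorus.strictFunctor J, inferInstance, fun _ => rfl, fun x z => ?_,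
    (CatTorus.isLineFunctor_strictFunctor J).isLieEquivalence rfl⟩
  -- On an automorphism with lattice part `0` the phase is `exp(J(x, 0) / 2) = 1`.
  refine CatTorus.CentralExt.ext ?_ CatTorus.lineLoop_zero
  change z * CatTorus.expC (1 / 2 * CatTorus.realForm J x (CatTorus.inclLat 0)) = z
  rw [map_zero, map_zero, mul_zero, CatTorus.expC_zero, mul_one]
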